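/- Let $X$ be a complex Hilbert space and let $\mathcal{A}$ be the generator of a $C^0$-semigroup on $X$. Assume that $X$ has a Riesz basis $(\varphi_n^i)_{1\le i\le m,\ n\ge 1}$ of eigenvectors of $\mathcal{A}$, $\mathcal{A}\varphi^i_n=\lambda^i_n\varphi^i_n$, such that for each $i$ the eigenvalues $(\lambda^i_n)_{n\ge1}$ are pairwise distinct, and that there are $\alpha_1,\dots,\alpha_m>1$ and constants $c,C,C'>0$ with $$c\,n^{\alpha_i}\le |\lambda_n^i|+1\le C\,n^{\alpha_i},\qquad |\lambda_n^i-\lambda_p^i|\ge C' n^{\alpha_i-1}|n-p|\qquad\text{for all } n,p\ge1,\ 1\le i\le m .$$ For $s\in\mathbb{R}$ let $\mathcal{H}_i^s$ be the Hilbert space of formal series $f=\sum_{n\ge1}f_n\varphi_n^i$ with $\|f\|_{\mathcal{H}_i^s}^2=\sum_{n\ge1} n^{2s}|f_n|^2<\infty$; $\mathcal{A}$ acts on formal series term by term. Let $\beta\in\mathbb{R}^m$ and $\gamma_j\in[0,(\alpha_j-1)/2)$ for $1\le j\le m$. Let $i\in\{1,\dots,m\}$, and let $B_i=\sum_n b_n\varphi_n^i\in\mathcal{H}_i^{\beta_i-\alpha_i/2}$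 satisfy, for some $c_1,c_2>0$, $$c_1 n^{-\beta_i}\le |b_n|\le c_2 n^{-\beta_i+\gamma_i}\qquad\text{for all } n\ge1 .$$ Let $\lambda\ge 0$ be a real number that is not of the form $\lambda_n^j-\lambda_p^j$ with $1\le j\le m$ and $n,p\ge1$. Then there exist a linear functional $K_i$ that is bounded on $\mathcal{H}_i^{\beta_i+1/2+\varepsilon}$ for every $\varepsilon>0$ (in particular on $\mathcal{H}_i^{\beta_i+\alpha_i/2}$) and a linear map $T_i$ that, for every $$r\in\left(\beta_i+\tfrac12-\alpha_i+\gamma_i,\ \beta_i+\alpha_i-\tfrac12-\gamma_i\right),$$ is an isomorphism of $\mathcal{H}_i^r$ onto itself and maps the system $\partial_t u=\mathcal{A}u+B_iK_i(u)$, $u\in\mathcal{H}_i^r$, to the system $\partial_t v=\mathcal{A}v-\lambda v$, $v\in\mathcal{H}_i^r$; the maps $K_i$ and $T_i$ do not depend on $\varepsilon$ and $r$. Here "maps the system" means the following. Give $\mathcal{A}+B_iK_i$ the domain of all $f\in\mathcal{H}_i^r$ such that $f\in\mathcal{H}_i^{\beta_i+1/2+\varepsilon}$ for some $\varepsilon>0$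 and $\mathcal{A}f+K_i(f)B_i\in\mathcal{H}_i^r$, and give $\mathcal{A}-\lambda$ the domain of all $f\in\mathcal{H}_i^r$ such that $(\mathcal{A}-\lambda)f\in\mathcal{H}_i^r$. Then $T_i$ maps the first domain onto the second, $T_i(\mathcal{A}+B_iK_i)=(\mathcal{A}-\lambda)T_i$ on the first domain, and a function $u:[0,\infty)\to\mathcal{H}_i^r$ is a classical (respectively mild) solution of the first system if and only if $v=T_iu$ is a classical (respectively mild) solution of the second. A classical solution is a $C^1$ function with values in the domain satisfying the equation on $[0,\infty)$; a mild solution of $\partial_tu=Gu$ is a continuous $u$ such that, for all $t\ge0$, $\int_0^tu$ lies in the domain of $G$ and $u(t)-u(0)=G\int_0^tu$. -/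

import Mathlib

open Set Filter Topology MeasureTheory

section Semigroups

variable {X : Type*} [NormedAddCommGroup X] [InnerProductSpace ℂ X]

/-- `S` (only its values at `t ≥ 0` matter) is a strongly continuous semigroup of bounded linear
operators on `X`. -/
structure IsC0Semigroup (S : ℝ → X →L[ℂ] X) : Prop where
  zero : S 0 = ContinuousLinearMap.id ℂ X
  add : ∀ t s : ℝ, 0 ≤ t → 0 ≤ s → S (t + s) = (S t).comp (S s)
  tendsto_zero : ∀ x : X, Tendsto (fun t : ℝ => S t x) (𝓝[>] 0) (𝓝 x)

/-- The (unbounded) operator `A` is the infinitesimal generator of `S`: one has `x ∈ D(A)` and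
`A x = y` exactly when `(S t x - x) / t → y` as `t → 0⁺`. -/
def IsGeneratorOf (A : X →ₗ.[ℂ] X) (S : ℝ → X →L[ℂ] X) : Prop :=
  ∀ x y : X, (x, y) ∈ A.graph ↔
    Tendsto (fun t : ℝ => (t⁻¹ : ℂ) • (S t x - x)) (𝓝[>] 0) (𝓝 y)

/-- A Riesz basis of `X`: a family with dense span, satisfying two-sided `ℓ²` bounds. -/
def IsRieszBasis {ι : Type*} (φ : ι → X) : Prop :=
  (Submodule.span ℂ (range φ)).topologicalClosure = ⊤ ∧
    ∃ c C : ℝ, 0 < c ∧ 0 < C ∧ ∀ a : ι →₀ ℂ,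
      c * ∑ j ∈ a.support, ‖a j‖ ^ 2 ≤ ‖∑ j ∈ a.support, a j • φ j‖ ^ 2 ∧
        ‖∑ j ∈ a.support, a j • φ j‖ ^ 2 ≤ C * ∑ j ∈ a.support, ‖a j‖ ^ 2

end Semigroups

section Scale

variable {X : Type*}

/-- The coefficient sequences `(fₙ)` with `∑ n^{2s} |fₙ|² < ∞`. -/
def weightedSeq (s : ℝ) : Submodule ℂ (ℕ+ → ℂ) where
  carrier := {f | Summable fun n : ℕ+ => ((n : ℕ) : ℝ) ^ (2 * s) * ‖f n‖ ^ 2}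
  zero_mem' := by simp
  add_mem' := by
    intro f g hf hg
    refine Summable.of_nonneg_of_le (fun n => by positivity) (fun n => ?_)
      ((hf.add hg).mul_left 2)
    have h1 : ‖f n + g n‖ ^ 2 ≤ 2 * (‖f n‖ ^ 2 + ‖g n‖ ^ 2) := by
      have := norm_add_le (f n) (g n)
      nlinarith [sq_nonneg (‖f n‖ - ‖g n‖), norm_nonneg (f n + g n)]
    have h2 : (0 : ℝ) ≤ ((n : ℕ) : ℝ) ^ (2 * s) := by positivity
    simp only [Pi.add_apply]
    nlinarith [mul_le_mul_of_nonneg_left h1 h2]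
  smul_mem' := by
    intro c f hf
    refine (hf.mul_left (‖c‖ ^ 2)).congr (fun n => ?_)
    simp only [Pi.smul_apply, smul_eq_mul, norm_mul]
    ring

/-- The space `𝓗ˢ` attached to a sequence `φ = (φₙ)`: the formal series `f = ∑ fₙ φₙ` with
`∑ n^{2s} |fₙ|² < ∞`. A formal series is stored through its coefficients; `φ` is kept in the type
so that series in different families are not mixed. -/
def SeriesSpace (_φ : ℕ+ → X) (s : ℝ) : Type := weightedSeq s

namespace SeriesSpace

variable {φ : ℕ+ → X} {s : ℝ}

instance : AddCommGroup (SeriesSpace φ s) := inferInstanceAs (AddCommGroup (weightedSeq s))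

instance : Module ℂ (SeriesSpace φ s) := inferInstanceAs (Module ℂ (weightedSeq s))

/-- The coefficients `fₙ` of `f = ∑ fₙ φₙ`. When `(φₙ)` is a Riesz basis of its closed span, with
biorthogonal family `(φ̃ₙ)`, they are the pairings `⟨f, φ̃ₙ⟩`. -/
def coeff (f : SeriesSpace φ s) : ℕ+ → ℂ := f.1

theorem coeff_injective : Function.Injective (coeff : SeriesSpace φ s → ℕ+ → ℂ) :=
  Subtype.val_injective

theorem norm_sq_weight (s : ℝ) (n : ℕ+) (z : ℂ) :
    ‖(((((n : ℕ) : ℝ) ^ s : ℝ)) : ℂ) * z‖ ^ 2 = ((n : ℕ) : ℝ) ^ (2 * s) * ‖z‖ ^ 2 := by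
  have hn : (0 : ℝ) ≤ ((n : ℕ) : ℝ) := by positivity
  rw [norm_mul, mul_pow, Complex.norm_real, Real.norm_of_nonneg (by positivity), mul_comm 2 s,
    Real.rpow_mul hn]
  norm_num

/-- The isomorphism `∑ fₙ φₙ ↦ (nˢ fₙ)` of `𝓗ˢ` with `ℓ²`. -/
noncomputable def toL2 (φ : ℕ+ → X) (s : ℝ) :
    SeriesSpace φ s ≃ₗ[ℂ] lp (fun _ : ℕ+ => ℂ) 2 where
  toFun f := ⟨fun n => (((((n : ℕ) : ℝ) ^ s : ℝ)) : ℂ) * coeff f n, by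
    refine (memℓp_gen_iff (by norm_num)).2 ?_
    refine Summable.congr (f := fun n : ℕ+ => ((n : ℕ) : ℝ) ^ (2 * s) * ‖coeff f n‖ ^ 2)
      f.2 (fun n => ?_)
    rw [← norm_sq_weight]
    norm_num⟩
  map_add' f g := by
    ext n
    exact mul_add _ _ _
  map_smul' c f := by
    ext n
    exact mul_left_comm _ _ _
  invFun a := ⟨fun n => (((((n : ℕ) : ℝ) ^ s : ℝ)) : ℂ)⁻¹ * a n, by
    have ha := (memℓp_gen_iff (by norm_num)).1 a.2
    refine Summable.congr ha (fun n => ?_)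
    have hn : (0 : ℝ) < ((n : ℕ) : ℝ) ^ s := Real.rpow_pos_of_pos (by exact_mod_cast n.pos) _
    rw [← norm_sq_weight, mul_inv_cancel_left₀ (by exact_mod_cast hn.ne')]
    norm_num⟩
  left_inv f := by
    apply coeff_injective
    funext n
    have hn : (0 : ℝ) < ((n : ℕ) : ℝ) ^ s := Real.rpow_pos_of_pos (by exact_mod_cast n.pos) _
    exact inv_mul_cancel_left₀ (by exact_mod_cast hn.ne') _
  right_inv a := by
    ext n
    have hn : (0 : ℝ) < ((n : ℕ) : ℝ) ^ s := Real.rpow_pos_of_pos (by exact_mod_cast n.pos) _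
    exact mul_inv_cancel_left₀ (by exact_mod_cast hn.ne') _

noncomputable instance : NormedAddCommGroup (SeriesSpace φ s) :=
  NormedAddCommGroup.induced (SeriesSpace φ s) (lp (fun _ : ℕ+ => ℂ) 2) (toL2 φ s) (toL2 φ s).injective

noncomputable instance : InnerProductSpace ℂ (SeriesSpace φ s) where
  toNormedSpace := NormedSpace.induced ℂ (SeriesSpace φ s) (lp (fun _ : ℕ+ => ℂ) 2) (toL2 φ s)
  inner f g := inner ℂ (toL2 φ s f) (toL2 φ s g)
  norm_sq_eq_re_inner f := norm_sq_eq_re_inner (𝕜 := ℂ) (toL2 φ s f)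
  conj_inner_symm f g := inner_conj_symm _ _
  add_left f g h := by rw [map_add, inner_add_left]
  smul_left f g c := by rw [map_smul, inner_smul_left]

/-- The norm is `(∑ n^{2s} |fₙ|²)^{1/2}`. -/
theorem norm_sq_eq (f : SeriesSpace φ s) :
    ‖f‖ ^ 2 = ∑' n : ℕ+, ((n : ℕ) : ℝ) ^ (2 * s) * ‖coeff f n‖ ^ 2 := by
  have h := lp.norm_rpow_eq_tsum (p := 2) (by norm_num) (toL2 φ s f)
  have h2 : ‖f‖ = ‖toL2 φ s f‖ := rfl
  rw [h2]
  refine Eq.trans (by norm_num) (h.trans (tsum_congr fun n => ?_))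
  rw [← norm_sq_weight, ENNReal.toReal_ofNat, Real.rpow_ofNat]
  rfl

instance : CompleteSpace (SeriesSpace φ s) := by
  have h : Isometry (toL2 φ s) := AddMonoidHomClass.isometry_of_norm _ (fun _ => rfl)
  exact (IsometryEquiv.mk (toL2 φ s).toEquiv h).completeSpace

end SeriesSpace

/-- A bounded linear functional on `𝓗ˢ` for every `s > σ`, consistently: the values at two
elements that are the same formal series agree. -/
structure Feedback (φ : ℕ+ → X) (σ : ℝ) where
  toFun : ∀ s : ℝ, σ < s → (SeriesSpace φ s →L[ℂ] ℂ)
  consistent : ∀ (s s' : ℝ) (hs : σ < s) (hs' : σ < s') (f : SeriesSpace φ s) (g : SeriesSpace φ s'),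
    f.coeff = g.coeff → toFun s hs f = toFun s' hs' g

/-- A linear map on formal series that is an isomorphism (bounded, with bounded inverse) of `𝓗ʳ`
onto itself for every `r ∈ (a, b)`, consistently in `r`. -/
structure ScaleIso (φ : ℕ+ → X) (a b : ℝ) where
  toEquiv : ∀ r ∈ Ioo a b, SeriesSpace φ r ≃L[ℂ] SeriesSpace φ r
  consistent : ∀ (r r' : ℝ) (hr : r ∈ Ioo a b) (hr' : r' ∈ Ioo a b)
    (f : SeriesSpace φ r) (g : SeriesSpace φ r'),
    f.coeff = g.coeff → (toEquiv r hr f).coeff = (toEquiv r' hr' g).coeff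

end Scale

section Systems

variable {X : Type*} [NormedAddCommGroup X] [InnerProductSpace ℂ X]

/-- `h = A f` for formal series `f = ∑ fₙ φₙ` and `h = ∑ hₙ φₙ` in eigenvectors `φₙ` of `A`:
`A` is applied term by term, `A (fₙ φₙ) = hₙ φₙ`. -/
def SeriesApply (A : X →ₗ.[ℂ] X) (φ : ℕ+ → X) (f h : ℕ+ → ℂ) : Prop :=
  ∀ n, (f n • φ n, h n • φ n) ∈ A.graph

/-- The graph of `A + BK` in `𝓗ʳ` with its maximal domain: `f ∈ 𝓗ʳ` belongs to `𝓗ˢ` for some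
`s > σ`, so that `K f` is defined, and `A f + (K f) B = g` belongs to `𝓗ʳ`. -/
def ClosedLoop (A : X →ₗ.[ℂ] X) {φ : ℕ+ → X} {τ σ : ℝ} (B : SeriesSpace φ τ) (K : Feedback φ σ)
    (r : ℝ) (f g : SeriesSpace φ r) : Prop :=
  ∃ (s : ℝ) (hs : σ < s) (f' : SeriesSpace φ s) (h : ℕ+ → ℂ),
    f'.coeff = f.coeff ∧ SeriesApply A φ f.coeff h ∧
      ∀ n, g.coeff n = h n + K.toFun s hs f' * B.coeff n

/-- The graph of `A - lam` in `𝓗ʳ` with its maximal domain. -/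
def Target (A : X →ₗ.[ℂ] X) {φ : ℕ+ → X} (lam : ℂ) (r : ℝ) (f g : SeriesSpace φ r) : Prop :=
  ∃ h : ℕ+ → ℂ, SeriesApply A φ f.coeff h ∧ ∀ n, g.coeff n = h n - lam * f.coeff n

variable {E : Type*} [NormedAddCommGroup E] [NormedSpace ℂ E]

/-- `u` is a classical solution on `[0, ∞)` of `∂ₜ u = G u`, where `G` is given by its graph:
`u` is `C¹` with values in `E`, stays in the domain of `G` and satisfies the equation. -/
def IsClassicalSolution (G : E → E → Prop) (u : ℝ → E) : Prop :=
  ∃ u' : ℝ → E, ContinuousOn u' (Ici 0) ∧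
    ∀ t, 0 ≤ t → HasDerivWithinAt u (u' t) (Ici 0) t ∧ G (u t) (u' t)

/-- `u` is a mild solution on `[0, ∞)` of `∂ₜ u = G u`, where `G` is given by its graph:
`u` is continuous and `u(t) - u(0) = G (∫₀ᵗ u)`. -/
def IsMildSolution (G : E → E → Prop) (u : ℝ → E) : Prop :=
  ContinuousOn u (Ici 0) ∧ ∀ t, 0 ≤ t → G (∫ s in (0 : ℝ)..t, u s) (u t - u 0)

/-- The isomorphism `T` of `E` maps the system `∂ₜ u = G₁ u` to the system `∂ₜ v = G₂ v`:
`T G₁ = G₂ T` with `T D(G₁) = D(G₂)`, and `u` solves the first system if and only if `v = T u`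
solves the second one, for classical and for mild solutions. -/
def MapsSystem (T : E ≃L[ℂ] E) (G₁ G₂ : E → E → Prop) : Prop :=
  (∀ f g : E, G₁ f g ↔ G₂ (T f) (T g)) ∧
    (∀ u : ℝ → E, IsClassicalSolution G₁ u ↔ IsClassicalSolution G₂ (fun t => T (u t))) ∧
    (∀ u : ℝ → E, IsMildSolution G₁ u ↔ IsMildSolution G₂ (fun t => T (u t)))

end Systems

/-! In the eigenbasis `A` is diagonal, with entries x_n. One looks for T with T B = B and T (A + B
K) = (A - λ) T. Given the first relation, the second reads T A + B K = (A - λ) T, that is, t_pn (x_n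
+ λ - x_p) = -b_p K_n. So T is the Cauchy matrix 1 / (x_n + λ - x_p) between two diagonal matrices:
writing K_n = -c_n / b_n, one gets t_pn = b_p c_n / ((x_n + λ - x_p) b_n), and T B = B becomes Σ_n
c_n / (x_n + λ - x_p) = 1 for every p. Non-resonance says that no denominator vanishes.

For finitely many indices Lagrange interpolation solves this system by c_n = λ ∏_{p ≠ n} (1 + λ /
(x_n - x_p)), and the inverse of T is the same matrix built from -x. The gap condition with α > 1
makes the products converge and bounds them uniformly, so both facts pass to the limit by dominated
convergence (`HasGap.tsum_cauchyWeight_mul_inv`, `HasGap.tsum_cauchyWeight_neg_mul`).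

Off the diagonal the entries of T and of its inverse are at most a constant times p^(-β+γ) n^β
max(n,p)^(1-α) / |n-p|. A Schur test with weights n^(1/2) then gives boundedness on 𝓗ʳ for r in the
given interval (`exists_schurBound`).

Equality of the domains is a regularity statement: if T f lies in the domain of A - λ, then it lies
in 𝓗^(r+α), where r + α > β + 1/2. Inverting T in a suitable 𝓗ˢ with s > β + 1/2 shows that K f is
defined. -/

/-! ### Finite Cauchy matrices and their inverses -/

section Cauchy

/-- The weights `lam * ∏ (1 + lam / (x n - x p))` over a finite set of indices. The factor at
`p = n` is `1`. -/
noncomputable def cauchyWeightOn {ι : Type*} (x : ι → ℂ) (lam : ℂ) (F : Finset ι) (n : ι) : ℂ :=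
  lam * ∏ p ∈ F, (1 + lam / (x n - x p))

/-- The weights `lam * ∏ (1 + lam / (x n - x p))` over all indices. -/
noncomputable def cauchyWeight {ι : Type*} (x : ι → ℂ) (lam : ℂ) (n : ι) : ℂ :=
  lam * ∏' p, (1 + lam / (x n - x p))

variable {ι : Type*} [DecidableEq ι] {x : ι → ℂ} {lam : ℂ}

/-- The factor `q = n` of the product is λ; each other factor pairs with the barycentric factor (x_n
- x_q)⁻¹ to give 1 + λ / (x_n - x_q). -/
theorem nodalWeight_mul_eval_nodal (hx : Function.Injective x) {F : Finset ι} {n : ι}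
    (hn : n ∈ F) :
    Lagrange.nodalWeight F (fun q => x q + lam) n * ∏ q ∈ F, (x n + lam - x q) =
      cauchyWeightOn x lam F n := by
  rw [Lagrange.nodalWeight, cauchyWeightOn, ← Finset.mul_prod_erase F _ hn,
    ← Finset.mul_prod_erase F (fun p => 1 + lam / (x n - x p)) hn]
  have h : ∏ q ∈ F.erase n, (1 + lam / (x n - x q)) =
      (∏ q ∈ F.erase n, (x n + lam - (x q + lam))⁻¹) * ∏ q ∈ F.erase n, (x n + lam - x q) := by
    rw [← Finset.prod_mul_distrib]
    refine Finset.prod_congr rfl fun q hq => ?_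
    have : x n - x q ≠ 0 := sub_ne_zero.2 fun h => (Finset.mem_erase.1 hq).1 (hx h).symm
    have h2 : x n + lam - (x q + lam) = x n - x q := by ring
    rw [h2]
    field_simp
    ring
  rw [h]
  simp
  ring

/-- The polynomial ∏ (X - x_q) - ∏ (X - x_q - λ) is a difference of monic polynomials of the same
degree, so it equals its interpolant at the nodes x_n + λ, where the second product vanishes. At X =
x_p the first product vanishes, and dividing by the second one gives the identity. -/
theorem sum_cauchyWeightOn_div (hx : Function.Injective x) (hres : ∀ n p, lam ≠ x n - x p)
    {F : Finset ι} {p : ι} (hp : p ∈ F) :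
    ∑ n ∈ F, cauchyWeightOn x lam F n / (x n + lam - x p) = 1 := by
  set v : ι → ℂ := fun q => x q + lam with hv
  have hvinj : Set.InjOn v F := fun a _ b _ h => hx (add_right_cancel h)
  set P : Polynomial ℂ := Lagrange.nodal F x - Lagrange.nodal F v with hP
  have hdeg : P.degree < F.card := by
    have h := Polynomial.degree_sub_lt_left (p := Lagrange.nodal F x) (q := Lagrange.nodal F v)
      (by rw [Lagrange.degree_nodal, Lagrange.degree_nodal]) Lagrange.nodal_ne_zero
      (by rw [Lagrange.nodal_monic.leadingCoeff, Lagrange.nodal_monic.leadingCoeff])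
    rwa [Lagrange.degree_nodal] at h
  have hne : ∀ n ∈ F, x p ≠ v n := fun n _ h => hres p n (by rw [h, hv]; ring)
  have h := congrArg (Polynomial.eval (x p))
    (Lagrange.eq_interpolate (f := P) hvinj hdeg)
  rw [Lagrange.eval_interpolate_not_at_node _ hne, hP, Polynomial.eval_sub,
    Lagrange.eval_nodal_at_node hp, zero_sub] at h
  have h0 : Polynomial.eval (x p) (Lagrange.nodal F v) ≠ 0 := by
    rw [Lagrange.eval_nodal]
    exact Finset.prod_ne_zero_iff.2 fun n hn => sub_ne_zero.2 (hne n hn)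
  rw [neg_eq_iff_eq_neg, ← mul_neg, eq_comm, mul_eq_left₀ h0] at h
  rw [← h, ← Finset.sum_neg_distrib]
  refine Finset.sum_congr rfl fun n hn => ?_
  rw [← nodalWeight_mul_eval_nodal hx hn, Polynomial.eval_sub, Lagrange.eval_nodal_at_node hn,
    Lagrange.eval_nodal, sub_zero]
  have h1 : x n + lam - x p = -(x p - v n) := by rw [hv]; ring
  rw [h1, div_neg, div_eq_mul_inv]
  ring

theorem sum_cauchyWeightOn_neg_div (hx : Function.Injective x) (hres : ∀ n p, lam ≠ x n - x p)
    {F : Finset ι} {n : ι} (hn : n ∈ F) :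
    ∑ p ∈ F, cauchyWeightOn (-x) lam F p / (x n + lam - x p) = 1 := by
  rw [← sum_cauchyWeightOn_div (x := -x) (neg_injective.comp hx)
    (fun n p h => hres p n (h.trans (by simp only [Pi.neg_apply]; ring))) hn]
  refine Finset.sum_congr rfl fun p _ => ?_
  congr 1
  simp only [Pi.neg_apply]
  ring

/-- For n ≠ k, partial fractions turn the sum into a difference of two sums equal to 1. The diagonal
then follows without computation: summing over k with both row identities gives 1, and only k = n
contributes. -/
theorem sum_cauchyWeightOn_neg_div_mul (hx : Function.Injective x)
    (hres : ∀ n p, lam ≠ x n - x p) {F : Finset ι} {n k : ι} (hn : n ∈ F) (hk : k ∈ F) :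
    ∑ p ∈ F, cauchyWeightOn (-x) lam F p * ((x n + lam - x p)⁻¹ * (x k + lam - x p)⁻¹) *
      cauchyWeightOn x lam F n = if n = k then 1 else 0 := by
  have hne : ∀ n p, x n + lam - x p ≠ 0 := fun n p h => hres p n (by linear_combination h)
  have off : ∀ {n k : ι}, n ∈ F → k ∈ F → n ≠ k →
      ∑ p ∈ F, cauchyWeightOn (-x) lam F p * ((x n + lam - x p)⁻¹ * (x k + lam - x p)⁻¹) = 0 := by
    intro n k hn hk hnk
    have hd : x n - x k ≠ 0 := sub_ne_zero.2 fun h => hnk (hx h)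
    refine (mul_right_inj' hd).1 ?_
    rw [mul_zero, Finset.mul_sum]
    rw [← sub_self (1 : ℂ)]
    nth_rewrite 1 [← sum_cauchyWeightOn_neg_div hx hres hk]
    rw [← sum_cauchyWeightOn_neg_div hx hres hn, ← Finset.sum_sub_distrib]
    refine Finset.sum_congr rfl fun p _ => ?_
    have h1 := hne n p
    have h2 := hne k p
    field_simp
    ring
  rw [← Finset.sum_mul]
  split_ifs with hnk
  · subst hnk
    have h : ∑ k ∈ F, (∑ p ∈ F, cauchyWeightOn (-x) lam F p *
        ((x n + lam - x p)⁻¹ * (x k + lam - x p)⁻¹)) * cauchyWeightOn x lam F k = 1 := by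
      simp_rw [Finset.sum_mul]
      rw [Finset.sum_comm, ← sum_cauchyWeightOn_neg_div hx hres hn]
      refine Finset.sum_congr rfl fun p hp => ?_
      rw [← mul_one (_ / _), ← sum_cauchyWeightOn_div hx hres hp, Finset.mul_sum]
      refine Finset.sum_congr rfl fun k _ => ?_
      rw [div_eq_mul_inv, div_eq_mul_inv]
      ring
    rwa [Finset.sum_eq_single_of_mem n hn fun k hk hkn => by
      rw [off hn hk hkn.symm, zero_mul]] at h
  · rw [off hn hk hnk, zero_mul]

end Cauchy

/-! ### Summable kernels on the positive integers -/

section Kernel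

theorem summable_abs_sub_rpow {e : ℝ} (he : 1 < e) (n : ℕ+) :
    Summable fun p : ℕ+ => |((n : ℕ) : ℝ) - ((p : ℕ) : ℝ)| ^ (-e) := by
  have hinj : Function.Injective fun p : ℕ+ => ((n : ℕ) : ℤ) - ((p : ℕ) : ℤ) := fun p q h => by
    simpa using h
  refine ((Real.summable_abs_int_rpow he).comp_injective hinj).congr fun p => ?_
  simp

theorem tsum_abs_sub_rpow_le {e : ℝ} (he : 1 < e) (n : ℕ+) :
    ∑' p : ℕ+, |((n : ℕ) : ℝ) - ((p : ℕ) : ℝ)| ^ (-e) ≤ ∑' k : ℤ, |(k : ℝ)| ^ (-e) := by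
  have hinj : Function.Injective fun p : ℕ+ => ((n : ℕ) : ℤ) - ((p : ℕ) : ℤ) := fun p q h => by
    simpa using h
  have h := tsum_comp_le_tsum_of_inj (Real.summable_abs_int_rpow he) (fun k => by positivity) hinj
  refine le_trans (le_of_eq (tsum_congr fun p => ?_)) h
  simp

/-- The kernel `max(n, p)^(1 - α) / |n - p|`, which vanishes on the diagonal. -/
noncomputable def gapKernel (α : ℝ) (n p : ℕ+) : ℝ :=
  (max ((n : ℕ) : ℝ) ((p : ℕ) : ℝ)) ^ (1 - α) * |((n : ℕ) : ℝ) - ((p : ℕ) : ℝ)|⁻¹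

variable {α : ℝ}

theorem gapKernel_comm (α : ℝ) (n p : ℕ+) : gapKernel α n p = gapKernel α p n := by
  rw [gapKernel, gapKernel, max_comm, abs_sub_comm]

theorem abs_natCast_sub_pos {n p : ℕ+} (h : n ≠ p) : 0 < |((n : ℕ) : ℝ) - ((p : ℕ) : ℝ)| := by
  rw [abs_pos, sub_ne_zero]
  exact fun h' => h (PNat.coe_injective (by exact_mod_cast h'))

theorem gapKernel_nonneg (α : ℝ) (n p : ℕ+) : 0 ≤ gapKernel α n p := by
  unfold gapKernel; positivity

theorem gapKernel_pos (α : ℝ) {n p : ℕ+} (h : n ≠ p) : 0 < gapKernel α n p := by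
  have := abs_natCast_sub_pos h
  have hn : (0 : ℝ) < (n : ℕ) := by exact_mod_cast n.pos
  have : 0 < max ((n : ℕ) : ℝ) ((p : ℕ) : ℝ) := lt_max_of_lt_left hn
  unfold gapKernel; positivity

/-- Since |n - p| ≤ max(n, p) and 1 - α < 0, the kernel is dominated by a convolution kernel,
summable uniformly in the row. -/
theorem gapKernel_le (hα : 1 < α) (n p : ℕ+) :
    gapKernel α n p ≤ |((n : ℕ) : ℝ) - ((p : ℕ) : ℝ)| ^ (-α) := by
  rcases eq_or_ne n p with rfl | h
  · simp only [gapKernel, sub_self, abs_zero, inv_zero, mul_zero]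
    positivity
  have h0 := abs_natCast_sub_pos h
  have hle : |((n : ℕ) : ℝ) - ((p : ℕ) : ℝ)| ≤ max ((n : ℕ) : ℝ) ((p : ℕ) : ℝ) := by
    have hn : (0 : ℝ) ≤ (n : ℕ) := by positivity
    have hp : (0 : ℝ) ≤ (p : ℕ) := by positivity
    rcases le_total ((n : ℕ) : ℝ) (p : ℕ) with h | h
    · rw [max_eq_right h, abs_le]; constructor <;> linarith
    · rw [max_eq_left h, abs_le]; constructor <;> linarith
  have h1 := Real.rpow_le_rpow_of_nonpos h0 hle (by linarith : 1 - α ≤ 0)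
  calc gapKernel α n p
      ≤ |((n : ℕ) : ℝ) - ((p : ℕ) : ℝ)| ^ (1 - α) * |((n : ℕ) : ℝ) - ((p : ℕ) : ℝ)|⁻¹ :=
        mul_le_mul_of_nonneg_right h1 (by positivity)
    _ = |((n : ℕ) : ℝ) - ((p : ℕ) : ℝ)| ^ (-α) := by
        rw [← Real.rpow_neg_one |_|, ← Real.rpow_add h0]
        congr 1
        ring

end Kernel

/-! ### Consequences of the spectral gap, and passage to infinite sums -/

section Gap

/-- The gap condition `|x n - x p| ≥ C n^(α - 1) |n - p|`. -/
def HasGap (α C : ℝ) (x : ℕ+ → ℂ) : Prop :=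
  ∀ n p : ℕ+, C * ((n : ℕ) : ℝ) ^ (α - 1) * |((n : ℕ) : ℝ) - ((p : ℕ) : ℝ)| ≤ ‖x n - x p‖

variable {α C : ℝ} {x : ℕ+ → ℂ} {lam : ℂ}

theorem HasGap.neg (h : HasGap α C x) : HasGap α C (-x) := fun n p => by
  have : (-x) n - (-x) p = -(x n - x p) := by simp only [Pi.neg_apply]; ring
  rw [this, norm_neg]
  exact h n p

theorem HasGap.mul_max_le (h : HasGap α C x) (n p : ℕ+) :
    C * (max ((n : ℕ) : ℝ) ((p : ℕ) : ℝ)) ^ (α - 1) * |((n : ℕ) : ℝ) - ((p : ℕ) : ℝ)| ≤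
      ‖x n - x p‖ := by
  rcases le_total ((n : ℕ) : ℝ) (p : ℕ) with h' | h'
  · rw [max_eq_right h', abs_sub_comm, norm_sub_rev]; exact h p n
  · rw [max_eq_left h']; exact h n p

theorem HasGap.injective (hC : 0 < C) (h : HasGap α C x) : Function.Injective x := by
  intro n p hnp
  by_contra hne
  have h1 := h n p
  have h2 := abs_natCast_sub_pos hne
  have hn : (0 : ℝ) < (n : ℕ) := by exact_mod_cast n.pos
  rw [hnp, sub_self, norm_zero] at h1
  exact absurd h1 (not_le.2 (by positivity))

theorem HasGap.norm_inv_le (hC : 0 < C) (h : HasGap α C x) (n p : ℕ+) :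
    ‖x n - x p‖⁻¹ ≤ C⁻¹ * gapKernel α n p := by
  rcases eq_or_ne n p with rfl | hne
  · simp [gapKernel]
  have h2 := abs_natCast_sub_pos hne
  have hn : (0 : ℝ) < (n : ℕ) := by exact_mod_cast n.pos
  have hm : 0 < max ((n : ℕ) : ℝ) ((p : ℕ) : ℝ) := lt_max_of_lt_left hn
  have e : C⁻¹ * gapKernel α n p = (C * (max ((n : ℕ) : ℝ) ((p : ℕ) : ℝ)) ^ (α - 1) *
      |((n : ℕ) : ℝ) - ((p : ℕ) : ℝ)|)⁻¹ := by
    rw [gapKernel, mul_inv, mul_inv, ← Real.rpow_neg hm.le, neg_sub, mul_assoc]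
  rw [e]
  exact inv_anti₀ (by positivity) (h.mul_max_le n p)

/-- If |x_n - x_p| ≥ 2|λ|, the shift costs at most a factor 2. The gap grows like max(n,p)^(α-1), so
only finitely many off-diagonal pairs remain; the constant absorbs them through the sum of their
ratios to the kernel. -/
theorem HasGap.exists_norm_inv_add_le (hα : 1 < α) (hC : 0 < C) (h : HasGap α C x)
    (lam : ℂ) : ∃ D : ℝ, 0 < D ∧ ∀ n p : ℕ+, n ≠ p →
      ‖x n + lam - x p‖⁻¹ ≤ D * gapKernel α n p := by
  obtain ⟨N, hN⟩ : ∃ N : ℕ, ∀ k : ℕ, N ≤ k → 2 * ‖lam‖ / C ≤ (k : ℝ) ^ (α - 1) :=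
    eventually_atTop.1 (((tendsto_rpow_atTop (by linarith : 0 < α - 1)).comp
      tendsto_natCast_atTop_atTop).eventually_ge_atTop _)
  set F : Finset (ℕ+ × ℕ+) := Finset.Iic N.succPNat ×ˢ Finset.Iic N.succPNat
  set R : ℕ+ × ℕ+ → ℝ := fun q => ‖x q.1 + lam - x q.2‖⁻¹ * (gapKernel α q.1 q.2)⁻¹ with hR
  have hR0 : ∀ q, 0 ≤ R q := fun q => mul_nonneg (by positivity)
    (inv_nonneg.2 (gapKernel_nonneg _ _ _))
  refine ⟨2 * C⁻¹ + ∑ q ∈ F, R q, add_pos_of_pos_of_nonneg (by positivity)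
    (Finset.sum_nonneg fun q _ => hR0 q), fun n p hnp => ?_⟩
  have hk := gapKernel_pos α hnp
  rw [add_mul]
  by_cases hbig : 2 * ‖lam‖ ≤ ‖x n - x p‖
  · have hx : 0 < ‖x n - x p‖ := norm_pos_iff.2 (sub_ne_zero.2 fun h' => hnp (h.injective hC h'))
    have h1 : ‖x n - x p‖ / 2 ≤ ‖x n + lam - x p‖ := by
      have := norm_sub_le (x n + lam - x p) lam
      rw [show x n + lam - x p - lam = x n - x p by ring] at this
      linarith
    have h2 : ‖x n + lam - x p‖⁻¹ ≤ 2 * ‖x n - x p‖⁻¹ := by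
      refine (inv_anti₀ (by positivity) h1).trans (le_of_eq ?_)
      rw [inv_div, div_eq_mul_inv]
    have h3 := h.norm_inv_le hC n p
    have h4 : 0 ≤ (∑ q ∈ F, R q) * gapKernel α n p :=
      mul_nonneg (Finset.sum_nonneg fun q _ => hR0 q) hk.le
    linarith
  · have hmax : ∀ k : ℕ+, (((k : ℕ) : ℝ) ≤ max ((n : ℕ) : ℝ) ((p : ℕ) : ℝ)) →
        k ∈ Finset.Iic N.succPNat := by
      intro k hk'
      rw [Finset.mem_Iic, ← PNat.coe_le_coe, Nat.succPNat_coe]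
      by_contra hlt
      have h1 := hN k (by omega)
      have h2 := h.mul_max_le n p
      have h3 : (1 : ℝ) ≤ |((n : ℕ) : ℝ) - ((p : ℕ) : ℝ)| := by
        have : (1 : ℤ) ≤ |((n : ℕ) : ℤ) - ((p : ℕ) : ℤ)| :=
          Int.one_le_abs (sub_ne_zero.2 fun h' => hnp (PNat.coe_injective (by exact_mod_cast h')))
        exact_mod_cast this
      have h4 := Real.rpow_le_rpow (by positivity) hk' (by linarith : 0 ≤ α - 1)
      rw [div_le_iff₀ hC] at h1
      have h5 : ((k : ℕ) : ℝ) ^ (α - 1) * C ≤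
          C * (max ((n : ℕ) : ℝ) ((p : ℕ) : ℝ)) ^ (α - 1) * |((n : ℕ) : ℝ) - ((p : ℕ) : ℝ)| := by
        rw [mul_comm]
        refine (mul_le_mul_of_nonneg_left h4 hC.le).trans (le_mul_of_one_le_right ?_ h3)
        positivity
      linarith
    have hmem : (n, p) ∈ F :=
      Finset.mem_product.2 ⟨hmax n (le_max_left _ _), hmax p (le_max_right _ _)⟩
    have h1 : R (n, p) ≤ ∑ q ∈ F, R q := Finset.single_le_sum (fun q _ => hR0 q) hmem
    have h2 : ‖x n + lam - x p‖⁻¹ = R (n, p) * gapKernel α n p := by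
      simp only [hR]
      rw [inv_mul_cancel_right₀ hk.ne']
    rw [h2]
    have h3 : 0 ≤ 2 * C⁻¹ * gapKernel α n p := by positivity
    have h4 := mul_le_mul_of_nonneg_right h1 hk.le
    linarith

theorem HasGap.summable_norm_inv_add (hα : 1 < α) (hC : 0 < C) (h : HasGap α C x)
    (lam : ℂ) (p : ℕ+) : Summable fun n : ℕ+ => ‖(x n + lam - x p)⁻¹‖ := by
  obtain ⟨D, hD, hle⟩ := h.exists_norm_inv_add_le hα hC lam
  refine Summable.of_norm_bounded_eventually ((summable_abs_sub_rpow hα p).mul_left D) ?_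
  filter_upwards [(Set.finite_singleton p).compl_mem_cofinite] with n hn
  rw [norm_norm, norm_inv]
  refine (hle n p hn).trans (mul_le_mul_of_nonneg_left ?_ hD.le)
  rw [abs_sub_comm]
  exact gapKernel_le hα n p

theorem HasGap.norm_div_le (hα : 1 < α) (hC : 0 < C) (h : HasGap α C x) (lam : ℂ)
    (n p : ℕ+) : ‖lam / (x n - x p)‖ ≤
      ‖lam‖ * C⁻¹ * |((n : ℕ) : ℝ) - ((p : ℕ) : ℝ)| ^ (-α) := by
  rw [norm_div, div_eq_mul_inv, mul_assoc]
  refine mul_le_mul_of_nonneg_left ((h.norm_inv_le hC n p).trans ?_) (norm_nonneg _)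
  exact mul_le_mul_of_nonneg_left (gapKernel_le hα n p) (by positivity)

theorem HasGap.summable_norm_div (hα : 1 < α) (hC : 0 < C) (h : HasGap α C x) (lam : ℂ)
    (n : ℕ+) : Summable fun p : ℕ+ => ‖lam / (x n - x p)‖ :=
  Summable.of_nonneg_of_le (fun _ => norm_nonneg _) (h.norm_div_le hα hC lam n)
    ((summable_abs_sub_rpow hα n).mul_left _)

theorem HasGap.tendsto_cauchyWeightOn (hα : 1 < α) (hC : 0 < C) (h : HasGap α C x) (lam : ℂ)
    (n : ℕ+) :
    Tendsto (fun F => cauchyWeightOn x lam F n) atTop (𝓝 (cauchyWeight x lam n)) :=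
  (multipliable_one_add_of_summable (h.summable_norm_div hα hC lam n)).hasProd.const_mul lam

/-- The bound ∏ (1 + a_p) ≤ exp Σ a_p is uniform in `F` and `n`; this is the domination needed for
the limit. -/
theorem HasGap.exists_norm_cauchyWeightOn_le (hα : 1 < α) (hC : 0 < C) (h : HasGap α C x)
    (lam : ℂ) : ∃ D : ℝ, 0 < D ∧ ∀ F n, ‖cauchyWeightOn x lam F n‖ ≤ D := by
  refine ⟨(‖lam‖ + 1) * Real.exp (‖lam‖ * C⁻¹ * ∑' k : ℤ, |(k : ℝ)| ^ (-α)), by positivity,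
    fun F n => ?_⟩
  rw [cauchyWeightOn, norm_mul, norm_prod]
  refine mul_le_mul (by linarith) ?_ (by positivity) (by positivity)
  calc ∏ p ∈ F, ‖1 + lam / (x n - x p)‖ ≤ ∏ p ∈ F, (1 + ‖lam / (x n - x p)‖) :=
        Finset.prod_le_prod (fun _ _ => norm_nonneg _) fun p _ =>
          (norm_add_le _ _).trans (by rw [norm_one])
    _ ≤ Real.exp (∑ p ∈ F, ‖lam / (x n - x p)‖) :=
        Real.prod_one_add_le_exp_sum _ fun _ => norm_nonneg _
    _ ≤ _ := by
        refine Real.exp_le_exp.2 ?_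
        calc ∑ p ∈ F, ‖lam / (x n - x p)‖
            ≤ ∑ p ∈ F, ‖lam‖ * C⁻¹ * |((n : ℕ) : ℝ) - ((p : ℕ) : ℝ)| ^ (-α) :=
              Finset.sum_le_sum fun p _ => h.norm_div_le hα hC lam n p
          _ ≤ ∑' p : ℕ+, ‖lam‖ * C⁻¹ * |((n : ℕ) : ℝ) - ((p : ℕ) : ℝ)| ^ (-α) :=
              ((summable_abs_sub_rpow hα n).mul_left _).sum_le_tsum _ fun _ _ => by positivity
          _ ≤ _ := by
              rw [tsum_mul_left]
              exact mul_le_mul_of_nonneg_left (tsum_abs_sub_rpow_le hα n) (by positivity)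

theorem HasGap.exists_norm_cauchyWeight_le (hα : 1 < α) (hC : 0 < C) (h : HasGap α C x)
    (lam : ℂ) : ∃ D : ℝ, 0 < D ∧ ∀ n, ‖cauchyWeight x lam n‖ ≤ D := by
  obtain ⟨D, hD, hle⟩ := h.exists_norm_cauchyWeightOn_le hα hC lam
  exact ⟨D, hD, fun n => le_of_tendsto (h.tendsto_cauchyWeightOn hα hC lam n).norm
    (Eventually.of_forall fun F => hle F n)⟩

/-- Dominated convergence when both the range of summation and the weights depend on `F`: the terms
are extended by 0 outside `F`. -/
theorem tendsto_sum_mul_of_dominated {ι : Type*} {w : Finset ι → ι → ℂ} {v g : ι → ℂ} {D : ℝ}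
    (hw : ∀ p, Tendsto (fun F => w F p) atTop (𝓝 (v p))) (hD : ∀ F p, ‖w F p‖ ≤ D)
    (hg : Summable fun p => ‖g p‖) :
    Tendsto (fun F => ∑ p ∈ F, w F p * g p) atTop (𝓝 (∑' p, v p * g p)) := by
  classical
  have h := tendsto_tsum_of_dominated_convergence (𝓕 := (atTop : Filter (Finset ι)))
    (f := fun F p => if p ∈ F then w F p * g p else 0) (g := fun p => v p * g p)
    (bound := fun p => D * ‖g p‖) (hg.mul_left D) (fun p => ?_)
    (Eventually.of_forall fun F p => ?_)
  · refine h.congr fun F => ?_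
    rw [tsum_eq_sum (s := F) fun p hp => if_neg hp]
    exact Finset.sum_congr rfl fun p hp => if_pos hp
  · refine ((hw p).mul_const (g p)).congr' ?_
    filter_upwards [eventually_ge_atTop {p}] with F hF
    rw [if_pos (hF (Finset.mem_singleton_self p))]
  · split_ifs
    · rw [norm_mul]
      exact mul_le_mul_of_nonneg_right (hD F p) (norm_nonneg _)
    · rw [norm_zero]
      exact mul_nonneg ((norm_nonneg _).trans (hD F p)) (norm_nonneg _)

theorem HasGap.summable_cauchyWeight_mul_inv (hα : 1 < α) (hC : 0 < C) (h : HasGap α C x)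
    (lam : ℂ) (p : ℕ+) :
    Summable fun n => ‖cauchyWeight x lam n * (x n + lam - x p)⁻¹‖ := by
  obtain ⟨D, hD, hle⟩ := h.exists_norm_cauchyWeight_le hα hC lam
  refine Summable.of_nonneg_of_le (fun _ => norm_nonneg _) (fun n => ?_)
    ((h.summable_norm_inv_add hα hC lam p).mul_left D)
  rw [norm_mul]
  exact mul_le_mul_of_nonneg_right (hle n) (norm_nonneg _)

theorem HasGap.tsum_cauchyWeight_mul_inv (hα : 1 < α) (hC : 0 < C) (h : HasGap α C x)
    (hres : ∀ n p, lam ≠ x n - x p) (p : ℕ+) :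
    ∑' n, cauchyWeight x lam n * (x n + lam - x p)⁻¹ = 1 := by
  obtain ⟨D, -, hle⟩ := h.exists_norm_cauchyWeightOn_le hα hC lam
  refine tendsto_nhds_unique (tendsto_sum_mul_of_dominated
    (h.tendsto_cauchyWeightOn hα hC lam) hle (h.summable_norm_inv_add hα hC lam p)) ?_
  refine tendsto_const_nhds.congr' ?_
  filter_upwards [eventually_ge_atTop {p}] with F hF
  exact (sum_cauchyWeightOn_div (h.injective hC) hres (hF (Finset.mem_singleton_self p))).symm

theorem HasGap.tsum_cauchyWeight_neg_mul (hα : 1 < α) (hC : 0 < C) (h : HasGap α C x)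
    (hres : ∀ n p, lam ≠ x n - x p) (n k : ℕ+) :
    ∑' p, cauchyWeight (-x) lam p * cauchyWeight x lam n *
      ((x n + lam - x p)⁻¹ * (x k + lam - x p)⁻¹) = if n = k then 1 else 0 := by
  obtain ⟨D, hD, hle⟩ := h.exists_norm_cauchyWeightOn_le hα hC lam
  obtain ⟨D', hD', hle'⟩ := h.neg.exists_norm_cauchyWeightOn_le hα hC lam
  have hsum : ∀ k : ℕ+, Summable fun p => ‖(x k + lam - x p)⁻¹‖ := fun k =>
    (h.neg.summable_norm_inv_add hα hC lam k).congr fun p => by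
      rw [Pi.neg_apply, Pi.neg_apply]
      ring_nf
  refine tendsto_nhds_unique (tendsto_sum_mul_of_dominated (D := D' * D)
    (w := fun F p => cauchyWeightOn (-x) lam F p * cauchyWeightOn x lam F n)
    (fun p => (h.neg.tendsto_cauchyWeightOn hα hC lam p).mul
      (h.tendsto_cauchyWeightOn hα hC lam n)) (fun F p => ?_) ?_) ?_
  · rw [norm_mul]
    exact mul_le_mul (hle' F p) (hle F n) (norm_nonneg _) hD'.le
  · refine Summable.of_nonneg_of_le (fun _ => norm_nonneg _) (fun p => ?_)
      ((hsum k).mul_left (∑' q, ‖(x n + lam - x q)⁻¹‖))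
    rw [norm_mul]
    exact mul_le_mul_of_nonneg_right ((hsum n).le_tsum p fun _ _ => norm_nonneg _)
      (norm_nonneg _)
  · refine tendsto_const_nhds.congr' ?_
    filter_upwards [eventually_ge_atTop {n, k}] with F hF
    rw [← sum_cauchyWeightOn_neg_div_mul (h.injective hC) hres (hF (by simp)) (hF (by simp)) (n := n)
      (k := k)]
    refine Finset.sum_congr rfl fun p _ => ?_
    ring

end Gap

/-! ### The Schur test and operators on weighted sequence spaces -/

section Schur

open scoped ENNReal

/-- Cauchy–Schwarz, as Hölder's inequality for the counting measure on the discrete σ-algebra. -/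
theorem ENNReal.tsum_sq_le_tsum_mul_tsum {ι : Type*} {k u v : ι → ℝ≥0∞}
    (h : ∀ n, k n ^ 2 = u n * v n) : (∑' n, k n) ^ 2 ≤ (∑' n, u n) * ∑' n, v n := by
  let _ : MeasurableSpace ι := ⊤
  have hroot : ∀ a : ℝ≥0∞, (a ^ (1 / 2 : ℝ)) ^ (2 : ℝ) = a := fun a => by
    rw [← ENNReal.rpow_mul]; norm_num
  have hroot' : ∀ a : ℝ≥0∞, (a ^ (1 / 2 : ℝ)) ^ 2 = a := fun a => by
    rw [← ENNReal.rpow_two, hroot]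
  have hk : ∀ n, k n = u n ^ (1 / 2 : ℝ) * v n ^ (1 / 2 : ℝ) := fun n => by
    rw [← ENNReal.mul_rpow_of_nonneg _ _ (by norm_num), ← h n, ← ENNReal.rpow_two,
      ← ENNReal.rpow_mul]
    norm_num
  have hCS := ENNReal.lintegral_mul_le_Lp_mul_Lq (Measure.count : Measure ι)
    (Real.HolderConjugate.two_two) (f := fun n => u n ^ (1 / 2 : ℝ))
    (g := fun n => v n ^ (1 / 2 : ℝ)) measurable_from_top.aemeasurable
    measurable_from_top.aemeasurable
  simp only [lintegral_count, Pi.mul_apply, hroot, ← hk] at hCS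
  calc (∑' n, k n) ^ 2 ≤ ((∑' n, u n) ^ (1 / 2 : ℝ) * (∑' n, v n) ^ (1 / 2 : ℝ)) ^ 2 := by
        gcongr
    _ = (∑' n, u n) * ∑' n, v n := by rw [mul_pow, hroot', hroot']

/-- The Schur test. -/
theorem ENNReal.tsum_sq_tsum_mul_le {ι κ : Type*} {k u v : ι → κ → ℝ≥0∞} {C : ℝ≥0∞}
    (h : ∀ p n, k p n ^ 2 = u p n * v p n) (hu : ∀ p, ∑' n, u p n ≤ C)
    (hv : ∀ n, ∑' p, v p n ≤ C) (g : κ → ℝ≥0∞) :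
    ∑' p, (∑' n, k p n * g n) ^ 2 ≤ C ^ 2 * ∑' n, g n ^ 2 := by
  calc ∑' p, (∑' n, k p n * g n) ^ 2 ≤ ∑' p, C * ∑' n, v p n * g n ^ 2 := by
        refine ENNReal.tsum_le_tsum fun p => ?_
        refine (ENNReal.tsum_sq_le_tsum_mul_tsum (u := u p) (v := fun n => v p n * g n ^ 2)
          fun n => ?_).trans (mul_le_mul_left (hu p) _)
        rw [mul_pow, h, mul_assoc]
    _ = C * ∑' n, (∑' p, v p n) * g n ^ 2 := by
        rw [ENNReal.tsum_mul_left, ENNReal.tsum_comm]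
        simp_rw [ENNReal.tsum_mul_right]
    _ ≤ C * ∑' n, C * g n ^ 2 := by
        refine mul_le_mul_right (ENNReal.tsum_le_tsum fun n => ?_) _
        exact mul_le_mul_left (hv n) _
    _ = C ^ 2 * ∑' n, g n ^ 2 := by rw [ENNReal.tsum_mul_left]; ring

/-- Row and column bounds on the matrix `t` that make it bounded on `𝓗ʳ`. -/
def SchurBound (r : ℝ) (t : ℕ+ → ℕ+ → ℂ) (C : ℝ) : Prop :=
  (∀ p : ℕ+, ∑' n : ℕ+, ENNReal.ofReal (((p : ℕ) : ℝ) ^ (r + 1 / 2) * ‖t p n‖ *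
      ((n : ℕ) : ℝ) ^ (-(r + 1 / 2))) ≤ ENNReal.ofReal C) ∧
    ∀ n : ℕ+, ∑' p : ℕ+, ENNReal.ofReal (((p : ℕ) : ℝ) ^ (r - 1 / 2) * ‖t p n‖ *
      ((n : ℕ) : ℝ) ^ (-(r - 1 / 2))) ≤ ENNReal.ofReal C

theorem natCast_pos (n : ℕ+) : (0 : ℝ) < ((n : ℕ) : ℝ) := by exact_mod_cast n.pos

theorem one_le_natCast (n : ℕ+) : (1 : ℝ) ≤ ((n : ℕ) : ℝ) := by exact_mod_cast n.2

theorem summable_of_tsum_ofReal_ne_top {ι : Type*} {f : ι → ℝ} (hf : ∀ n, 0 ≤ f n)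
    (h : ∑' n, ENNReal.ofReal (f n) ≠ ⊤) : Summable f :=
  (ENNReal.summable_toReal h).congr fun n => ENNReal.toReal_ofReal (hf n)

namespace SeriesSpace

variable {X : Type*} {φ : ℕ+ → X} {r : ℝ}

theorem summable_coeff (f : SeriesSpace φ r) :
    Summable fun n : ℕ+ => ((n : ℕ) : ℝ) ^ (2 * r) * ‖f.coeff n‖ ^ 2 := f.2

theorem ofReal_norm_sq (f : SeriesSpace φ r) :
    ENNReal.ofReal (‖f‖ ^ 2) =
      ∑' n : ℕ+, ENNReal.ofReal (((n : ℕ) : ℝ) ^ r * ‖f.coeff n‖) ^ 2 := by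
  rw [norm_sq_eq, ENNReal.ofReal_tsum_of_nonneg (fun n => by positivity) f.summable_coeff]
  refine tsum_congr fun n => ?_
  rw [← ENNReal.ofReal_pow (by positivity), mul_pow, ← Real.rpow_natCast (_ ^ r),
    ← Real.rpow_mul (natCast_pos n).le, mul_comm r]
  norm_num

theorem tsum_matrix_le {t : ℕ+ → ℕ+ → ℂ} {C : ℝ} (h : SchurBound r t C) (f : SeriesSpace φ r) :
    ∑' p : ℕ+, (∑' n, ENNReal.ofReal (((p : ℕ) : ℝ) ^ r * ‖t p n * f.coeff n‖)) ^ 2 ≤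
      ENNReal.ofReal C ^ 2 * ENNReal.ofReal (‖f‖ ^ 2) := by
  rw [ofReal_norm_sq]
  refine le_trans (le_of_eq (tsum_congr fun p => ?_)) (ENNReal.tsum_sq_tsum_mul_le
    (k := fun p n : ℕ+ => ENNReal.ofReal (((p : ℕ) : ℝ) ^ r * ‖t p n‖ * ((n : ℕ) : ℝ) ^ (-r)))
    (fun p n => ?_) h.1 h.2 _)
  · congr 1
    refine tsum_congr fun n => ?_
    rw [← ENNReal.ofReal_mul (by positivity), norm_mul, Real.rpow_neg (natCast_pos n).le]
    have : ((n : ℕ) : ℝ) ^ r ≠ 0 := (Real.rpow_pos_of_pos (natCast_pos n) r).ne'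
    congr 1
    field_simp
  · rw [← ENNReal.ofReal_mul (by positivity), ← ENNReal.ofReal_pow (by positivity)]
    congr 1
    -- The exponents r + 1/2 and r - 1/2 average to r, so the row and column kernels multiply to the
    -- square of the kernel conjugated by n^r.
    have e1 : ∀ m : ℕ+, ∀ a b c : ℝ, a + b = c + c →
        ((m : ℕ) : ℝ) ^ a * ((m : ℕ) : ℝ) ^ b = ((m : ℕ) : ℝ) ^ c * ((m : ℕ) : ℝ) ^ c := by
      intro m a b c habc
      rw [← Real.rpow_add (natCast_pos m), ← Real.rpow_add (natCast_pos m), habc]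
    have h1 := e1 p (r + 1 / 2) (r - 1 / 2) r (by ring)
    have h2 := e1 n (-(r + 1 / 2)) (-(r - 1 / 2)) (-r) (by ring)
    linear_combination (-‖t p n‖ ^ 2 * (((n : ℕ) : ℝ) ^ (-(r + 1 / 2)) *
      ((n : ℕ) : ℝ) ^ (-(r - 1 / 2)))) * h1 -
      (‖t p n‖ ^ 2 * (((p : ℕ) : ℝ) ^ r) ^ 2) * h2

theorem summable_matrix {t : ℕ+ → ℕ+ → ℂ} {C : ℝ} (h : SchurBound r t C) (f : SeriesSpace φ r)
    (p : ℕ+) : Summable fun n => t p n * f.coeff n := by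
  have hfin : ∑' n, ENNReal.ofReal (((p : ℕ) : ℝ) ^ r * ‖t p n * f.coeff n‖) ≠ ⊤ := by
    intro htop
    have h1 := (ENNReal.le_tsum p).trans (tsum_matrix_le h f)
    rw [htop] at h1
    exact absurd h1 (not_le.2 (by
      rw [ENNReal.top_pow two_ne_zero]
      exact ENNReal.mul_lt_top (ENNReal.pow_lt_top ENNReal.ofReal_lt_top) ENNReal.ofReal_lt_top))
  have h2 := summable_of_tsum_ofReal_ne_top (fun n => by positivity) hfin
  rw [summable_mul_left_iff (Real.rpow_pos_of_pos (natCast_pos p) r).ne'] at h2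
  exact h2.of_norm

theorem tsum_matrix_weight_le {t : ℕ+ → ℕ+ → ℂ} {C : ℝ} (hC : 0 ≤ C) (h : SchurBound r t C)
    (f : SeriesSpace φ r) :
    ∑' p : ℕ+, ENNReal.ofReal (((p : ℕ) : ℝ) ^ r * ‖∑' n, t p n * f.coeff n‖) ^ 2 ≤
      ENNReal.ofReal (C ^ 2 * ‖f‖ ^ 2) := by
  rw [ENNReal.ofReal_mul (by positivity), ENNReal.ofReal_pow hC]
  refine le_trans (ENNReal.tsum_le_tsum fun p => ?_) (tsum_matrix_le h f)
  have hs := (summable_matrix h f p).norm.mul_left (((p : ℕ) : ℝ) ^ r)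
  rw [← ENNReal.ofReal_tsum_of_nonneg (fun n => by positivity) hs, tsum_mul_left]
  gcongr
  exact norm_tsum_le_tsum_norm (summable_matrix h f p).norm

theorem exists_matrix_clm {t : ℕ+ → ℕ+ → ℂ} {C : ℝ} (hC : 0 ≤ C) (h : SchurBound r t C) :
    ∃ L : SeriesSpace φ r →L[ℂ] SeriesSpace φ r,
      ∀ f p, HasSum (fun n => t p n * f.coeff n) ((L f).coeff p) := by
  have hle := fun f : SeriesSpace φ r => tsum_matrix_weight_le hC h f
  have hmem : ∀ f : SeriesSpace φ r, (fun p => ∑' n, t p n * f.coeff n) ∈ weightedSeq r := by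
    intro f
    refine summable_of_tsum_ofReal_ne_top (fun n => by positivity)
      (ne_top_of_le_ne_top ENNReal.ofReal_ne_top (le_trans (le_of_eq ?_) (hle f)))
    refine tsum_congr fun n => ?_
    rw [← ENNReal.ofReal_pow (by positivity), mul_pow, ← Real.rpow_natCast (_ ^ r),
      ← Real.rpow_mul (natCast_pos n).le, mul_comm r]
    norm_num
  let L : SeriesSpace φ r →ₗ[ℂ] SeriesSpace φ r :=
    { toFun := fun f => ⟨fun p => ∑' n, t p n * f.coeff n, hmem f⟩
      map_add' := fun f g => coeff_injective <| funext fun p => by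
        change ∑' n, t p n * (f.coeff n + g.coeff n) = _ + _
        simp_rw [mul_add]
        exact (summable_matrix h f p).tsum_add (summable_matrix h g p)
      map_smul' := fun c f => coeff_injective <| funext fun p => by
        change ∑' n, t p n * (c * f.coeff n) = c * _
        simp_rw [mul_left_comm _ c]
        exact tsum_mul_left }
  refine ⟨L.mkContinuous C fun f => ?_, fun f p => (summable_matrix h f p).hasSum⟩
  refine (sq_le_sq₀ (norm_nonneg _) (by positivity)).1 ?_
  rw [mul_pow, ← ENNReal.ofReal_le_ofReal_iff (by positivity), ofReal_norm_sq]
  exact hle f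

/-- The formal series with the single coefficient `1` at `n`. -/
noncomputable def single (φ : ℕ+ → X) (r : ℝ) (n : ℕ+) : SeriesSpace φ r :=
  ⟨Pi.single n 1, summable_of_ne_finset_zero (s := {n}) fun p hp => by
    rw [Pi.single_eq_of_ne (by simpa using hp)]; simp⟩

theorem coeff_single (n p : ℕ+) : (single φ r n).coeff p = if p = n then 1 else 0 := by
  change (Pi.single n 1 : ℕ+ → ℂ) p = _
  rw [Pi.single_apply]

/-- `toL2` as an isometry. -/
noncomputable def toL2Isometry (φ : ℕ+ → X) (r : ℝ) :
    SeriesSpace φ r ≃ₗᵢ[ℂ] lp (fun _ : ℕ+ => ℂ) 2 :=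
  { toL2 φ r with norm_map' := fun _ => rfl }

theorem toL2Isometry_apply (f : SeriesSpace φ r) (n : ℕ+) :
    toL2Isometry φ r f n = (((((n : ℕ) : ℝ) ^ r : ℝ)) : ℂ) * f.coeff n := rfl

theorem hasSum_single (f : SeriesSpace φ r) :
    HasSum (fun n => f.coeff n • single φ r n) f := by
  have h := (lp.hasSum_single (by norm_num) (toL2Isometry φ r f)).mapL
    ((toL2Isometry φ r).symm.toContinuousLinearEquiv : _ →L[ℂ] SeriesSpace φ r)
  simp only [ContinuousLinearEquiv.coe_coe, LinearIsometryEquiv.coe_toContinuousLinearEquiv,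
    LinearIsometryEquiv.symm_apply_apply] at h
  refine h.congr_fun fun n => ?_
  rw [LinearIsometryEquiv.eq_symm_apply]
  ext p
  rw [toL2Isometry_apply, lp.single_apply, toL2Isometry_apply]
  change _ * (f.coeff n * (single φ r n).coeff p) = _
  rw [coeff_single]
  by_cases hpn : p = n
  · subst hpn; simp
  · simp [hpn]

theorem clm_ext {F : Type*} [NormedAddCommGroup F] [NormedSpace ℂ F]
    {L M : SeriesSpace φ r →L[ℂ] F} (h : ∀ n, L (single φ r n) = M (single φ r n)) : L = M := by
  ext f
  refine (f.hasSum_single.mapL L).unique ?_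
  convert f.hasSum_single.mapL M using 2 with n
  rw [map_smul, map_smul, h]

/-- The dual of 𝓗ʳ is 𝓗⁻ʳ; the conjugate of `κ` represents the functional through the ℓ² inner
product. -/
theorem exists_functional {κ : ℕ+ → ℂ}
    (h : Summable fun n : ℕ+ => ((n : ℕ) : ℝ) ^ (2 * (-r)) * ‖κ n‖ ^ 2) :
    ∃ L : SeriesSpace φ r →L[ℂ] ℂ, ∀ f, HasSum (fun n => κ n * f.coeff n) (L f) := by
  let g : lp (fun _ : ℕ+ => ℂ) 2 := toL2 φ (-r) ⟨fun n => star (κ n), by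
    refine Summable.congr h fun n => ?_
    rw [norm_star]⟩
  refine ⟨(innerSL ℂ g).comp
    ((toL2Isometry φ r).toContinuousLinearEquiv : SeriesSpace φ r →L[ℂ] _), fun f => ?_⟩
  refine (lp.hasSum_inner g (toL2Isometry φ r f)).congr_fun fun n => ?_
  rw [toL2Isometry_apply]
  change _ = inner ℂ ((((((n : ℕ) : ℝ) ^ (-r) : ℝ)) : ℂ) * star (κ n)) _
  rw [RCLike.inner_apply, map_mul, Complex.conj_ofReal, Real.rpow_neg (natCast_pos n).le]
  have : ((((n : ℕ) : ℝ) ^ r : ℝ) : ℂ) ≠ 0 := by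
    exact_mod_cast (Real.rpow_pos_of_pos (natCast_pos n) r).ne'
  simp
  field_simp

end SeriesSpace

end Schur

/-! ### Weighted row and column sums of the gap kernel -/

section KernelBounds

theorem rpow_neg_mul_inv_sub_le {x y δ : ℝ} (hx : 0 < x) (hxy : x < y) (hδ : 0 ≤ δ) :
    y ^ (-δ) * (y - x)⁻¹ ≤ (y - x) ^ (-(1 + δ)) := by
  have hd : 0 < y - x := sub_pos.2 hxy
  rw [show -(1 + δ) = -δ + -1 by ring, Real.rpow_add hd, Real.rpow_neg_one]
  exact mul_le_mul_of_nonneg_right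
    (Real.rpow_le_rpow_of_nonpos hd (by linarith) (by linarith)) (by positivity)

/-- Partial fractions: y / (x (y - x)) = 1/x + 1/(y - x), after which y^(-δ) is bounded by the same
power of x or of y - x. -/
theorem rpow_mul_inv_mul_inv_sub_le {x y δ : ℝ} (hx : 0 < x) (hxy : x < y) (hδ : 0 ≤ δ) :
    y ^ (1 - δ) * x⁻¹ * (y - x)⁻¹ ≤ x ^ (-(1 + δ)) + (y - x) ^ (-(1 + δ)) := by
  have hd : 0 < y - x := sub_pos.2 hxy
  have hy : 0 < y := hx.trans hxy
  have h1 : y ^ (1 - δ) * x⁻¹ * (y - x)⁻¹ = y ^ (-δ) * x⁻¹ + y ^ (-δ) * (y - x)⁻¹ := by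
    rw [sub_eq_add_neg, Real.rpow_add hy, Real.rpow_one]
    field_simp
    ring
  rw [h1]
  refine add_le_add ?_ (rpow_neg_mul_inv_sub_le hx hxy hδ)
  rw [show -(1 + δ) = -δ + -1 by ring, Real.rpow_add hx, Real.rpow_neg_one]
  exact mul_le_mul_of_nonneg_right
    (Real.rpow_le_rpow_of_nonpos hx hxy.le (by linarith)) (by positivity)

variable {α γ δ s : ℝ}

theorem rpow_le_rpow_of_lower (h1 : s + γ + 1 / 2 - α + δ ≤ 0) (h3 : γ + 1 - α + δ ≤ 0)
    {n p : ℕ+} (h : ((n : ℕ) : ℝ) ≤ (p : ℕ)) :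
    ((p : ℕ) : ℝ) ^ (s + γ + 1 / 2 - α + δ) ≤ ((n : ℕ) : ℝ) ^ (s - 1 / 2) :=
  (Real.rpow_le_rpow_of_nonpos (natCast_pos n) h h1).trans
    (Real.rpow_le_rpow_of_exponent_le (one_le_natCast n) (by linarith))

theorem rpow_le_rpow_of_upper (h2 : 0 ≤ s + α - 1 / 2 - δ) (h3 : γ + 1 - α + δ ≤ 0)
    {n p : ℕ+} (h : ((p : ℕ) : ℝ) ≤ (n : ℕ)) :
    ((p : ℕ) : ℝ) ^ (s + γ + 1 / 2) ≤ ((n : ℕ) : ℝ) ^ (s + α - 1 / 2 - δ) :=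
  (Real.rpow_le_rpow_of_exponent_le (one_le_natCast p) (by linarith)).trans
    (Real.rpow_le_rpow (natCast_pos p).le h h2)

/-- Here `s` plays the role of r - β. For n < p the left side is at most p^(1-δ) n⁻¹ (p-n)⁻¹, for n
> p at most n^(-δ) (n-p)⁻¹, and for n = p the kernel vanishes. -/
theorem rpow_mul_gapKernel_le_row (hδ : 0 ≤ δ) (h1 : s + γ + 1 / 2 - α + δ ≤ 0)
    (h2 : 0 ≤ s + α - 1 / 2 - δ) (h3 : γ + 1 - α + δ ≤ 0) (n p : ℕ+) :
    ((p : ℕ) : ℝ) ^ (s + γ + 1 / 2) * ((n : ℕ) : ℝ) ^ (-(s + 1 / 2)) * gapKernel α p n ≤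
      ((n : ℕ) : ℝ) ^ (-(1 + δ)) + |((p : ℕ) : ℝ) - ((n : ℕ) : ℝ)| ^ (-(1 + δ)) := by
  have hn := natCast_pos n
  have hp := natCast_pos p
  rw [gapKernel]
  rcases lt_trichotomy ((n : ℕ) : ℝ) (p : ℕ) with h | h | h
  · have hd : 0 < ((p : ℕ) : ℝ) - (n : ℕ) := sub_pos.2 h
    rw [max_eq_left h.le, abs_of_pos hd]
    refine le_trans ?_ (rpow_mul_inv_mul_inv_sub_le hn h hδ)
    rw [← mul_assoc]
    refine mul_le_mul_of_nonneg_right ?_ (by positivity)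
    have e1 : ((p : ℕ) : ℝ) ^ (s + γ + 1 / 2) * ((n : ℕ) : ℝ) ^ (-(s + 1 / 2)) *
        ((p : ℕ) : ℝ) ^ (1 - α) = ((p : ℕ) : ℝ) ^ (s + γ + 1 / 2 - α + δ) *
          (((p : ℕ) : ℝ) ^ (1 - δ) * ((n : ℕ) : ℝ) ^ (-(s + 1 / 2))) := by
      rw [mul_right_comm, ← Real.rpow_add hp, ← mul_assoc, ← Real.rpow_add hp]
      ring_nf
    have e2 : ((p : ℕ) : ℝ) ^ (1 - δ) * ((n : ℕ) : ℝ)⁻¹ = ((n : ℕ) : ℝ) ^ (s - 1 / 2) *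
          (((p : ℕ) : ℝ) ^ (1 - δ) * ((n : ℕ) : ℝ) ^ (-(s + 1 / 2))) := by
      rw [mul_left_comm, ← Real.rpow_add hn, ← Real.rpow_neg_one]
      ring_nf
    rw [e1, e2]
    exact mul_le_mul_of_nonneg_right (rpow_le_rpow_of_lower h1 h3 h.le) (by positivity)
  · rw [h, sub_self, abs_zero, inv_zero, mul_zero, mul_zero]
    positivity
  · have hd : 0 < ((n : ℕ) : ℝ) - (p : ℕ) := sub_pos.2 h
    rw [max_eq_right h.le, abs_sub_comm, abs_of_pos hd]
    refine le_trans ?_ ((rpow_neg_mul_inv_sub_le hp h hδ).trans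
      (le_add_of_nonneg_left (by positivity)))
    rw [← mul_assoc]
    refine mul_le_mul_of_nonneg_right ?_ (by positivity)
    have e2 : ((n : ℕ) : ℝ) ^ (-δ) = ((n : ℕ) : ℝ) ^ (s + α - 1 / 2 - δ) *
          (((n : ℕ) : ℝ) ^ (-(s + 1 / 2)) * ((n : ℕ) : ℝ) ^ (1 - α)) := by
      rw [← Real.rpow_add hn, ← Real.rpow_add hn]
      ring_nf
    rw [e2, mul_assoc]
    exact mul_le_mul_of_nonneg_right (rpow_le_rpow_of_upper h2 h3 h.le) (by positivity)

/-- As for rows with the two regions exchanged: partial fractions are now needed for n > p. -/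
theorem rpow_mul_gapKernel_le_col (hδ : 0 ≤ δ) (h1 : s + γ + 1 / 2 - α + δ ≤ 0)
    (h2 : 0 ≤ s + α - 1 / 2 - δ) (h3 : γ + 1 - α + δ ≤ 0) (n p : ℕ+) :
    ((p : ℕ) : ℝ) ^ (s + γ - 1 / 2) * ((n : ℕ) : ℝ) ^ (-(s - 1 / 2)) * gapKernel α p n ≤
      ((p : ℕ) : ℝ) ^ (-(1 + δ)) + |((n : ℕ) : ℝ) - ((p : ℕ) : ℝ)| ^ (-(1 + δ)) := by
  have hn := natCast_pos n
  have hp := natCast_pos p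
  rw [gapKernel]
  rcases lt_trichotomy ((n : ℕ) : ℝ) (p : ℕ) with h | h | h
  · have hd : 0 < ((p : ℕ) : ℝ) - (n : ℕ) := sub_pos.2 h
    rw [max_eq_left h.le, abs_sub_comm ((n : ℕ) : ℝ), abs_of_pos hd]
    refine le_trans ?_ ((rpow_neg_mul_inv_sub_le hn h hδ).trans
      (le_add_of_nonneg_left (by positivity)))
    rw [← mul_assoc]
    refine mul_le_mul_of_nonneg_right ?_ (by positivity)
    have e1 : ((p : ℕ) : ℝ) ^ (s + γ - 1 / 2) * ((n : ℕ) : ℝ) ^ (-(s - 1 / 2)) *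
        ((p : ℕ) : ℝ) ^ (1 - α) = ((p : ℕ) : ℝ) ^ (s + γ + 1 / 2 - α + δ) *
          (((p : ℕ) : ℝ) ^ (-δ) * ((n : ℕ) : ℝ) ^ (-(s - 1 / 2))) := by
      rw [mul_right_comm, ← Real.rpow_add hp, ← mul_assoc, ← Real.rpow_add hp]
      ring_nf
    have e2 : ((p : ℕ) : ℝ) ^ (-δ) = ((n : ℕ) : ℝ) ^ (s - 1 / 2) *
          (((p : ℕ) : ℝ) ^ (-δ) * ((n : ℕ) : ℝ) ^ (-(s - 1 / 2))) := by
      rw [mul_left_comm, ← Real.rpow_add hn, add_neg_cancel, Real.rpow_zero, mul_one]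
    refine e1.le.trans (le_trans ?_ e2.symm.le)
    exact mul_le_mul_of_nonneg_right (rpow_le_rpow_of_lower h1 h3 h.le) (by positivity)
  · rw [h, sub_self, abs_zero, inv_zero, mul_zero, mul_zero]
    positivity
  · have hd : 0 < ((n : ℕ) : ℝ) - (p : ℕ) := sub_pos.2 h
    rw [max_eq_right h.le, abs_sub_comm ((p : ℕ) : ℝ), abs_of_pos hd]
    refine le_trans ?_ (rpow_mul_inv_mul_inv_sub_le hp h hδ)
    rw [← mul_assoc]
    refine mul_le_mul_of_nonneg_right ?_ (by positivity)
    have e1 : ((p : ℕ) : ℝ) ^ (s + γ - 1 / 2) * ((n : ℕ) : ℝ) ^ (-(s - 1 / 2)) *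
        ((n : ℕ) : ℝ) ^ (1 - α) = ((p : ℕ) : ℝ) ^ (s + γ + 1 / 2) * (((p : ℕ) : ℝ)⁻¹ *
          (((n : ℕ) : ℝ) ^ (-(s - 1 / 2)) * ((n : ℕ) : ℝ) ^ (1 - α))) := by
      rw [← Real.rpow_neg_one, ← mul_assoc (_ ^ (s + γ + 1 / 2)), ← Real.rpow_add hp, mul_assoc]
      ring_nf
    have e2 : ((n : ℕ) : ℝ) ^ (1 - δ) * ((p : ℕ) : ℝ)⁻¹ =
        ((n : ℕ) : ℝ) ^ (s + α - 1 / 2 - δ) * (((p : ℕ) : ℝ)⁻¹ *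
          (((n : ℕ) : ℝ) ^ (-(s - 1 / 2)) * ((n : ℕ) : ℝ) ^ (1 - α))) := by
      rw [mul_left_comm, ← Real.rpow_add hn, ← Real.rpow_add hn, mul_comm]
      ring_nf
    rw [e1, e2]
    exact mul_le_mul_of_nonneg_right (rpow_le_rpow_of_upper h2 h3 h.le) (by positivity)

theorem tsum_ofReal_le_of_kernel_le {e D : ℝ} (he : 1 < e) (hD : 0 ≤ D) (p : ℕ+) {f : ℕ+ → ℝ}
    (hf : ∀ n, f n ≤ D * (((n : ℕ) : ℝ) ^ (-e) + |((p : ℕ) : ℝ) - ((n : ℕ) : ℝ)| ^ (-e)) +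
      if n = p then D else 0) :
    ∑' n, ENNReal.ofReal (f n) ≤
      ENNReal.ofReal (D * (2 * ∑' k : ℤ, |(k : ℝ)| ^ (-e)) + D) := by
  have hinj : Function.Injective fun n : ℕ+ => ((n : ℕ) : ℤ) := fun p q h => by simpa using h
  have hs0 := Real.summable_abs_int_rpow he
  have hs1 : Summable fun n : ℕ+ => ((n : ℕ) : ℝ) ^ (-e) :=
    (hs0.comp_injective hinj).congr fun n => by simp
  have hs2 := summable_abs_sub_rpow he p
  have ht1 : ∑' n : ℕ+, ((n : ℕ) : ℝ) ^ (-e) ≤ ∑' k : ℤ, |(k : ℝ)| ^ (-e) :=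
    le_trans (le_of_eq (tsum_congr fun n => by simp))
      (tsum_comp_le_tsum_of_inj hs0 (fun k => by positivity) hinj)
  have ht2 := tsum_abs_sub_rpow_le he p
  have h12 := (hs1.hasSum.add hs2.hasSum).mul_left D
  have h := h12.add (hasSum_ite_eq p D)
  refine (ENNReal.tsum_le_tsum fun n => ENNReal.ofReal_le_ofReal (hf n)).trans ?_
  rw [← ENNReal.ofReal_tsum_of_nonneg (fun n => ?_) h.summable, h.tsum_eq]
  · refine ENNReal.ofReal_le_ofReal (add_le_add (mul_le_mul_of_nonneg_left ?_ hD) le_rfl)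
    linarith
  · split_ifs <;> positivity

theorem exists_schurBound {t : ℕ+ → ℕ+ → ℂ} {β r D : ℝ} (hγ : 0 ≤ γ) (hγα : γ < α - 1)
    (hr : r ∈ Ioo (β + 1 / 2 - α + γ) (β + α - 1 / 2 - γ)) (hD : 0 ≤ D)
    (hdiag : ∀ p, ‖t p p‖ ≤ D)
    (hoff : ∀ p n : ℕ+, n ≠ p → ‖t p n‖ ≤
      D * (((p : ℕ) : ℝ) ^ (-β + γ) * ((n : ℕ) : ℝ) ^ β * gapKernel α p n)) :
    ∃ C, 0 ≤ C ∧ SchurBound r t C := by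
  -- The slack left by the two endpoints of the interval and by γ < α - 1; it supplies the summable
  -- exponent 1 + δ.
  set δ : ℝ := min (β + α - 1 / 2 - γ - r) (min (r - (β + 1 / 2 - α + γ)) (α - 1 - γ)) with hδ
  have hδ0 : 0 < δ := lt_min (by linarith [hr.2]) (lt_min (by linarith [hr.1]) (by linarith))
  have hδ1 : δ ≤ β + α - 1 / 2 - γ - r := min_le_left _ _
  have hδ2 : δ ≤ r - (β + 1 / 2 - α + γ) := (min_le_right _ _).trans (min_le_left _ _)
  have hδ3 : δ ≤ α - 1 - γ := (min_le_right _ _).trans (min_le_right _ _)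
  have h1 : (r - β) + γ + 1 / 2 - α + δ ≤ 0 := by linarith
  have h2 : 0 ≤ (r - β) + α - 1 / 2 - δ := by linarith
  have h3 : γ + 1 - α + δ ≤ 0 := by linarith
  have key : ∀ (a : ℝ) (p n : ℕ+), ((p : ℕ) : ℝ) ^ a * ‖t p n‖ * ((n : ℕ) : ℝ) ^ (-a) ≤
      D * (((p : ℕ) : ℝ) ^ (a - β + γ) * ((n : ℕ) : ℝ) ^ (-(a - β)) * gapKernel α p n) +
        if n = p then D else 0 := by
    intro a p n
    have hn := natCast_pos n
    have hp := natCast_pos p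
    split_ifs with hnp
    · subst hnp
      rw [mul_right_comm, ← Real.rpow_add hn, add_neg_cancel, Real.rpow_zero, one_mul]
      have := gapKernel_nonneg α n n
      exact (hdiag n).trans (le_add_of_nonneg_left (by positivity))
    · rw [add_zero]
      have h := mul_le_mul_of_nonneg_left (hoff p n hnp)
        (by positivity : 0 ≤ ((p : ℕ) : ℝ) ^ a * ((n : ℕ) : ℝ) ^ (-a))
      refine le_trans (le_of_eq (by ring)) (h.trans (le_of_eq ?_))
      rw [show a - β + γ = a + (-β + γ) by ring, show -(a - β) = -a + β by ring,
        Real.rpow_add hp a, Real.rpow_add hn (-a)]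
      ring
  refine ⟨D * (2 * ∑' k : ℤ, |(k : ℝ)| ^ (-(1 + δ))) + D, ?_, fun p => ?_, fun n => ?_⟩
  · have : 0 ≤ ∑' k : ℤ, |(k : ℝ)| ^ (-(1 + δ)) := tsum_nonneg fun k => by positivity
    positivity
  · refine tsum_ofReal_le_of_kernel_le (by linarith) hD p fun n => (key _ p n).trans ?_
    have h := rpow_mul_gapKernel_le_row hδ0.le h1 h2 h3 n p
    rw [show r + 1 / 2 - β + γ = r - β + γ + 1 / 2 by ring,
      show r + 1 / 2 - β = r - β + 1 / 2 by ring]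
    gcongr
  · refine tsum_ofReal_le_of_kernel_le (by linarith) hD n fun p => (key _ p n).trans ?_
    have h := rpow_mul_gapKernel_le_col hδ0.le h1 h2 h3 n p
    rw [show r - 1 / 2 - β + γ = r - β + γ - 1 / 2 by ring,
      show r - 1 / 2 - β = r - β - 1 / 2 by ring]
    simp only [eq_comm (a := p)]
    gcongr

end KernelBounds

/-! ### The backstepping transformation and the feedback -/

section Transformation

/-- The matrix `b p * c n / ((x n + lam - x p) * b n)` of the backstepping transformation, where
`c` are the weights of the Cauchy matrix. -/
noncomputable def cauchyMatrix (x b : ℕ+ → ℂ) (lam : ℂ) (p n : ℕ+) : ℂ :=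
  b p * cauchyWeight x lam n * (x n + lam - x p)⁻¹ * (b n)⁻¹

/-- The coefficients of the feedback functional. -/
noncomputable def feedbackCoeff (x b : ℕ+ → ℂ) (lam : ℂ) (n : ℕ+) : ℂ :=
  -(cauchyWeight x lam n * (b n)⁻¹)

/-- The two-sided bounds on the control coefficients. -/
def ControlBounds (β γ c₁ c₂ : ℝ) (b : ℕ+ → ℂ) : Prop :=
  ∀ n : ℕ+, c₁ * ((n : ℕ) : ℝ) ^ (-β) ≤ ‖b n‖ ∧ ‖b n‖ ≤ c₂ * ((n : ℕ) : ℝ) ^ (-β + γ)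

variable {X : Type*} {φ : ℕ+ → X} {x b : ℕ+ → ℂ} {lam : ℂ} {α β γ C c₁ c₂ r s : ℝ}

theorem ControlBounds.ne_zero (hc₁ : 0 < c₁) (hb : ControlBounds β γ c₁ c₂ b) (n : ℕ+) :
    b n ≠ 0 := by
  have := natCast_pos n
  exact norm_pos_iff.1 (lt_of_lt_of_le (by positivity) (hb n).1)

theorem ControlBounds.norm_inv_le (hc₁ : 0 < c₁) (hb : ControlBounds β γ c₁ c₂ b) (n : ℕ+) :
    ‖(b n)⁻¹‖ ≤ c₁⁻¹ * ((n : ℕ) : ℝ) ^ β := by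
  have := natCast_pos n
  rw [norm_inv]
  refine (inv_anti₀ (by positivity) (hb n).1).trans (le_of_eq ?_)
  rw [mul_inv, Real.rpow_neg this.le, inv_inv]

theorem exists_schurBound_cauchyMatrix (hα : 1 < α) (hC : 0 < C) (h : HasGap α C x)
    (hc₁ : 0 < c₁) (hc₂ : 0 < c₂) (hb : ControlBounds β γ c₁ c₂ b) (hγ : 0 ≤ γ)
    (hγα : γ < α - 1) (lam : ℂ)
    (hr : r ∈ Ioo (β + 1 / 2 - α + γ) (β + α - 1 / 2 - γ)) :
    ∃ D, 0 ≤ D ∧ SchurBound r (cauchyMatrix x b lam) D := by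
  obtain ⟨D₁, hD₁, hle₁⟩ := h.exists_norm_cauchyWeight_le hα hC lam
  obtain ⟨D₂, hD₂, hle₂⟩ := h.exists_norm_inv_add_le hα hC lam
  -- The first summand serves the diagonal, where the entry is c_p / λ; the second serves the other
  -- entries.
  refine exists_schurBound hγ hγα hr (D := D₁ * ‖lam⁻¹‖ + c₂ * D₁ * D₂ * c₁⁻¹) (by positivity)
    (fun p => ?_) fun p n hnp => ?_
  · have e : cauchyMatrix x b lam p p = cauchyWeight x lam p * lam⁻¹ := by
      have := hb.ne_zero hc₁ p
      rw [cauchyMatrix, add_sub_cancel_left]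
      field_simp
    rw [e, norm_mul]
    exact (mul_le_mul_of_nonneg_right (hle₁ p) (norm_nonneg _)).trans
      (le_add_of_nonneg_right (by positivity))
  · have hk := gapKernel_nonneg α p n
    have h3 : ‖(x n + lam - x p)⁻¹‖ ≤ D₂ * gapKernel α p n := by
      rw [norm_inv, gapKernel_comm]
      exact hle₂ n p hnp
    rw [cauchyMatrix, norm_mul, norm_mul, norm_mul]
    calc ‖b p‖ * ‖cauchyWeight x lam n‖ * ‖(x n + lam - x p)⁻¹‖ * ‖(b n)⁻¹‖
        ≤ (c₂ * ((p : ℕ) : ℝ) ^ (-β + γ)) * D₁ * (D₂ * gapKernel α p n) *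
            (c₁⁻¹ * ((n : ℕ) : ℝ) ^ β) := by
          have h1 := (hb p).2
          have h2 := hle₁ n
          have h4 := hb.norm_inv_le hc₁ n
          gcongr
      _ = (c₂ * D₁ * D₂ * c₁⁻¹) *
            (((p : ℕ) : ℝ) ^ (-β + γ) * ((n : ℕ) : ℝ) ^ β * gapKernel α p n) := by ring
      _ ≤ _ := by
          refine mul_le_mul_of_nonneg_right ?_ (by positivity)
          exact le_add_of_nonneg_left (by positivity)

theorem tsum_cauchyMatrix_neg_mul (hα : 1 < α) (hC : 0 < C) (h : HasGap α C x)
    (hres : ∀ n p, lam ≠ x n - x p) (hb : ∀ n, b n ≠ 0) (k n : ℕ+) :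
    ∑' p, cauchyMatrix (-x) b lam k p * cauchyMatrix x b lam p n = if k = n then 1 else 0 := by
  have e : ∀ p, cauchyMatrix (-x) b lam k p * cauchyMatrix x b lam p n =
      b k * (b n)⁻¹ * (cauchyWeight (-x) lam p * cauchyWeight x lam n *
        ((x n + lam - x p)⁻¹ * (x k + lam - x p)⁻¹)) := fun p => by
    have := hb p
    rw [cauchyMatrix, cauchyMatrix, Pi.neg_apply, Pi.neg_apply,
      show -x p + lam - -x k = x k + lam - x p by ring]
    field_simp
  simp_rw [e]
  rw [tsum_mul_left, h.tsum_cauchyWeight_neg_mul hα hC hres]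
  by_cases hkn : k = n
  · subst hkn; simp [hb k]
  · simp [hkn, Ne.symm hkn]

theorem resonance_neg (hres : ∀ n p, lam ≠ x n - x p) (n p : ℕ+) :
    lam ≠ (-x) n - (-x) p := fun h =>
  hres p n (h.trans (by simp only [Pi.neg_apply]; ring))

namespace SeriesSpace

theorem coeff_apply_single {L : SeriesSpace φ r →L[ℂ] SeriesSpace φ r} {t : ℕ+ → ℕ+ → ℂ}
    (hL : ∀ f p, HasSum (fun n => t p n * f.coeff n) ((L f).coeff p)) (p n : ℕ+) :
    (L (single φ r n)).coeff p = t p n := by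
  refine (hL _ p).unique ?_
  refine (hasSum_ite_eq n (t p n)).congr_fun fun k => ?_
  rw [coeff_single]
  split_ifs with hk
  · rw [hk, mul_one]
  · rw [mul_zero]

theorem comp_eq_id_of_tsum {L M : SeriesSpace φ r →L[ℂ] SeriesSpace φ r} {t u : ℕ+ → ℕ+ → ℂ}
    (hL : ∀ f p, HasSum (fun n => t p n * f.coeff n) ((L f).coeff p))
    (hM : ∀ f p, HasSum (fun n => u p n * f.coeff n) ((M f).coeff p))
    (htu : ∀ k n, ∑' p, t k p * u p n = if k = n then 1 else 0) (f : SeriesSpace φ r) :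
    L (M f) = f := by
  have : L.comp M = ContinuousLinearMap.id ℂ _ := clm_ext fun n => coeff_injective <| funext
    fun k => by
      rw [ContinuousLinearMap.comp_apply, ContinuousLinearMap.id_apply, coeff_single, ← htu,
        ← (hL _ k).tsum_eq]
      exact tsum_congr fun p => by rw [coeff_apply_single hM]
  exact DFunLike.congr_fun this f

end SeriesSpace

theorem exists_cauchyEquiv (φ : ℕ+ → X) (hα : 1 < α) (hC : 0 < C) (h : HasGap α C x)
    (hres : ∀ n p, lam ≠ x n - x p) (hc₁ : 0 < c₁) (hc₂ : 0 < c₂)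
    (hb : ControlBounds β γ c₁ c₂ b) (hγ : 0 ≤ γ) (hγα : γ < α - 1)
    (hr : r ∈ Ioo (β + 1 / 2 - α + γ) (β + α - 1 / 2 - γ)) :
    ∃ T : SeriesSpace φ r ≃L[ℂ] SeriesSpace φ r,
      (∀ f p, HasSum (fun n => cauchyMatrix x b lam p n * f.coeff n) ((T f).coeff p)) ∧
      ∀ f p, HasSum (fun n => cauchyMatrix (-x) b lam p n * f.coeff n)
        ((T.symm f).coeff p) := by
  obtain ⟨D, hD, hS⟩ := exists_schurBound_cauchyMatrix hα hC h hc₁ hc₂ hb hγ hγα lam hr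
  obtain ⟨D', hD', hS'⟩ := exists_schurBound_cauchyMatrix hα hC h.neg hc₁ hc₂ hb hγ hγα lam hr
  obtain ⟨L, hL⟩ := SeriesSpace.exists_matrix_clm (φ := φ) hD hS
  obtain ⟨M, hM⟩ := SeriesSpace.exists_matrix_clm (φ := φ) hD' hS'
  have hne := hb.ne_zero hc₁
  refine ⟨ContinuousLinearEquiv.equivOfInverse L M
    (SeriesSpace.comp_eq_id_of_tsum hM hL (tsum_cauchyMatrix_neg_mul hα hC h hres hne))
    (SeriesSpace.comp_eq_id_of_tsum hL hM fun k n => ?_), hL, hM⟩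
  have := tsum_cauchyMatrix_neg_mul hα hC h.neg (resonance_neg hres) hne k n
  rwa [neg_neg] at this

/-- The weights are bounded and |b_n|⁻¹ = O(n^β), so the coefficients are square summable against
n^(-2s) as soon as 2(β - s) < -1. -/
theorem exists_feedbackFunctional (φ : ℕ+ → X) (hα : 1 < α) (hC : 0 < C) (h : HasGap α C x)
    (lam : ℂ) (hc₁ : 0 < c₁) (hb : ControlBounds β γ c₁ c₂ b) (hs : β + 1 / 2 < s) :
    ∃ L : SeriesSpace φ s →L[ℂ] ℂ,
      ∀ f, HasSum (fun n => feedbackCoeff x b lam n * f.coeff n) (L f) := by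
  obtain ⟨D, hD, hle⟩ := h.exists_norm_cauchyWeight_le hα hC lam
  refine SeriesSpace.exists_functional ?_
  have hsum : Summable fun n : ℕ+ => ((n : ℕ) : ℝ) ^ (2 * (β - s)) :=
    (Real.summable_nat_rpow.2 (by linarith)).comp_injective PNat.coe_injective
  refine Summable.of_nonneg_of_le (fun n => by positivity) (fun n => ?_)
    (hsum.mul_left ((D * c₁⁻¹) ^ 2))
  have hn := natCast_pos n
  have h1 : ‖feedbackCoeff x b lam n‖ ≤ D * c₁⁻¹ * ((n : ℕ) : ℝ) ^ β := by
    rw [feedbackCoeff, norm_neg, norm_mul, mul_assoc]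
    exact mul_le_mul (hle n) (hb.norm_inv_le hc₁ n) (norm_nonneg _) hD.le
  calc ((n : ℕ) : ℝ) ^ (2 * (-s)) * ‖feedbackCoeff x b lam n‖ ^ 2
      ≤ ((n : ℕ) : ℝ) ^ (2 * (-s)) * (D * c₁⁻¹ * ((n : ℕ) : ℝ) ^ β) ^ 2 := by gcongr
    _ = (D * c₁⁻¹) ^ 2 * ((n : ℕ) : ℝ) ^ (2 * (β - s)) := by
        rw [mul_pow _ (_ ^ β), ← Real.rpow_natCast (_ ^ β), ← Real.rpow_mul hn.le, mul_left_comm,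
          ← Real.rpow_add hn]
        push_cast
        ring_nf

/-- The feedback functional composed with the inverse transformation. -/
theorem feedback_comp_eq (hα : 1 < α) (hC : 0 < C) (h : HasGap α C x)
    (hres : ∀ n p, lam ≠ x n - x p) (hb : ∀ n, b n ≠ 0)
    {S : SeriesSpace φ s →L[ℂ] SeriesSpace φ s} {K L : SeriesSpace φ s →L[ℂ] ℂ}
    (hS : ∀ f p, HasSum (fun n => cauchyMatrix (-x) b lam p n * f.coeff n) ((S f).coeff p))
    (hK : ∀ f, HasSum (fun n => feedbackCoeff x b lam n * f.coeff n) (K f))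
    (hL : ∀ f, HasSum (fun n => feedbackCoeff (-x) b lam n * f.coeff n) (L f))
    (w : SeriesSpace φ s) : K (S w) = L w := by
  -- By continuity basis vectors suffice; at the p-th one the sum over n is a multiple of Σ_n c_n /
  -- (x_n + λ - x_p) = 1.
  have : K.comp S = L := SeriesSpace.clm_ext fun p => by
    have hLp : L (SeriesSpace.single φ s p) = feedbackCoeff (-x) b lam p := by
      refine (hL _).unique ((hasSum_ite_eq p _).congr_fun fun k => ?_)
      rw [SeriesSpace.coeff_single]
      split_ifs with hk
      · rw [hk, mul_one]
      · rw [mul_zero]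
    rw [ContinuousLinearMap.comp_apply, hLp, ← (hK _).tsum_eq]
    have e : ∀ n, feedbackCoeff x b lam n * (S (SeriesSpace.single φ s p)).coeff n =
        feedbackCoeff (-x) b lam p * (cauchyWeight x lam n * (x n + lam - x p)⁻¹) := fun n => by
      have := hb n
      rw [SeriesSpace.coeff_apply_single hS, feedbackCoeff, feedbackCoeff, cauchyMatrix,
        Pi.neg_apply, Pi.neg_apply, show -x p + lam - -x n = x n + lam - x p by ring]
      field_simp
    simp_rw [e]
    rw [tsum_mul_left, h.tsum_cauchyWeight_mul_inv hα hC hres, mul_one]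
  exact DFunLike.congr_fun this w

/-- The transformation conjugates `A + BK` to `A - lam`. -/
theorem coeff_transform_closedLoop (hα : 1 < α) (hC : 0 < C) (h : HasGap α C x)
    (hres : ∀ n p, lam ≠ x n - x p) (hb : ∀ n, b n ≠ 0)
    {T : SeriesSpace φ r → SeriesSpace φ r}
    (hT : ∀ f p, HasSum (fun n => cauchyMatrix x b lam p n * f.coeff n) ((T f).coeff p))
    {f g : SeriesSpace φ r} {κ : ℂ}
    (hκ : HasSum (fun n => feedbackCoeff x b lam n * f.coeff n) κ)
    (hg : ∀ n, g.coeff n = x n * f.coeff n + κ * b n) (p : ℕ+) :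
    (T g).coeff p = x p * (T f).coeff p - lam * (T f).coeff p := by
  have h1 : HasSum (fun n => cauchyWeight x lam n * (x n + lam - x p)⁻¹) 1 := by
    rw [← h.tsum_cauchyWeight_mul_inv hα hC hres p]
    exact (h.summable_cauchyWeight_mul_inv hα hC lam p).of_norm.hasSum
  -- The first series comes from t_pn x_n = (x_p - λ) t_pn - b_p K_n and the last from T B = B;
  -- their sums cancel. Only T B is expanded as a series, so `B` need not lie in 𝓗ʳ.
  have h2 := ((hκ.mul_left (-b p)).add ((hT f p).mul_left (x p - lam))).add
    (h1.mul_left (κ * b p))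
  have h3 := (hT g p).unique (h2.congr_fun fun n => ?_)
  · rw [h3]; ring
  · have hbn := hb n
    have hd : x n + lam - x p ≠ 0 := fun h0 => hres p n (by linear_combination h0)
    rw [hg, cauchyMatrix, feedbackCoeff]
    field_simp
    ring

/-- The inverse transformation conjugates `A - lam` to `A + BK`. -/
theorem coeff_inverse_target (hres : ∀ n p, lam ≠ x n - x p)
    {S : SeriesSpace φ r → SeriesSpace φ r}
    (hS : ∀ f p, HasSum (fun n => cauchyMatrix (-x) b lam p n * f.coeff n) ((S f).coeff p))
    {w z : SeriesSpace φ r} {κ : ℂ}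
    (hκ : HasSum (fun n => feedbackCoeff (-x) b lam n * w.coeff n) κ)
    (hz : ∀ p, z.coeff p = x p * w.coeff p - lam * w.coeff p) (n : ℕ+) :
    (S z).coeff n = x n * (S w).coeff n + κ * b n := by
  have h2 := ((hS w n).mul_left (x n)).add (hκ.mul_right (b n))
  refine (hS z n).unique (h2.congr_fun fun p => ?_)
  have hd : x n + lam - x p ≠ 0 := fun h0 => hres p n (by linear_combination h0)
  rw [hz, cauchyMatrix, feedbackCoeff, Pi.neg_apply, Pi.neg_apply,
    show -x p + lam - -x n = x n + lam - x p by ring]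
  linear_combination (-(b n * cauchyWeight (-x) lam p * (b p)⁻¹ * w.coeff p)) *
    mul_inv_cancel₀ hd

/-- Elliptic gain: |x_p - λ| ≥ (c/2) p^α for all but finitely many p, so a solution of (A - λ) w = z
is α orders more regular than z. -/
theorem mem_weightedSeq_of_target {c : ℝ} (hc : 0 < c) (hα : 0 < α)
    (hgrowth : ∀ n : ℕ+, c * ((n : ℕ) : ℝ) ^ α ≤ ‖x n‖ + 1) {w z : ℕ+ → ℂ}
    (hz : z ∈ weightedSeq r) (hwz : ∀ p, z p = x p * w p - lam * w p) (hs : s ≤ r + α) :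
    w ∈ weightedSeq s := by
  have hev : ∀ᶠ p : ℕ+ in cofinite, 2 * (1 + ‖lam‖) / c ≤ ((p : ℕ) : ℝ) ^ α := by
    have h1 : Tendsto (fun p : ℕ+ => (p : ℕ)) cofinite atTop := by
      rw [← Nat.cofinite_eq_atTop]
      exact PNat.coe_injective.tendsto_cofinite
    exact ((tendsto_rpow_atTop hα).comp
      (tendsto_natCast_atTop_atTop.comp h1)).eventually_ge_atTop _
  have hz' : Summable fun n : ℕ+ => ((n : ℕ) : ℝ) ^ (2 * r) * ‖z n‖ ^ 2 := hz
  refine Summable.of_norm_bounded_eventually (hz'.mul_left ((2 / c) ^ 2)) ?_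
  filter_upwards [hev] with p hp
  have hp0 := natCast_pos p
  rw [div_le_iff₀ hc] at hp
  have h1 : c / 2 * ((p : ℕ) : ℝ) ^ α * ‖w p‖ ≤ ‖z p‖ := by
    rw [hwz, ← sub_mul, norm_mul]
    refine mul_le_mul_of_nonneg_right ?_ (norm_nonneg _)
    have := norm_sub_norm_le (x p) lam
    have := hgrowth p
    nlinarith
  have h2 : ((p : ℕ) : ℝ) ^ (2 * s) ≤ ((p : ℕ) : ℝ) ^ (2 * r) * (((p : ℕ) : ℝ) ^ α) ^ 2 := by
    rw [← Real.rpow_natCast (_ ^ α), ← Real.rpow_mul hp0.le, ← Real.rpow_add hp0]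
    refine Real.rpow_le_rpow_of_exponent_le (one_le_natCast p) ?_
    push_cast
    linarith
  rw [Real.norm_of_nonneg (by positivity)]
  calc ((p : ℕ) : ℝ) ^ (2 * s) * ‖w p‖ ^ 2
      ≤ ((p : ℕ) : ℝ) ^ (2 * r) * (((p : ℕ) : ℝ) ^ α) ^ 2 * ‖w p‖ ^ 2 := by gcongr
    _ = (2 / c) ^ 2 * (((p : ℕ) : ℝ) ^ (2 * r) *
          (c / 2 * ((p : ℕ) : ℝ) ^ α * ‖w p‖) ^ 2) := by field_simp
    _ ≤ _ := by gcongr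

end Transformation

/-! ### Transport of graphs and solutions -/

section Systems

variable {X : Type*} [NormedAddCommGroup X] [InnerProductSpace ℂ X]

theorem IsRieszBasis.ne_zero {ι : Type*} {φ : ι → X} (h : IsRieszBasis φ) (j : ι) :
    φ j ≠ 0 := by
  obtain ⟨-, c, C, hc, -, hle⟩ := h
  intro h0
  have h1 := (hle (Finsupp.single j 1)).1
  simp [h0, Finsupp.support_single] at h1
  exact absurd h1 (not_le.2 hc)

theorem seriesApply_iff {A : X →ₗ.[ℂ] X} {φ : ℕ+ → X} {μ : ℕ+ → ℂ}
    (heig : ∀ n, (φ n, μ n • φ n) ∈ A.graph) (hφ : ∀ n, φ n ≠ 0) {f h : ℕ+ → ℂ} :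
    SeriesApply A φ f h ↔ ∀ n, h n = μ n * f n := by
  refine forall_congr' fun n => ?_
  have h1 : (f n • φ n, (μ n * f n) • φ n) ∈ A.graph := by
    have := A.graph.smul_mem (f n) (heig n)
    rwa [Prod.smul_mk, smul_smul, mul_comm] at this
  refine ⟨fun h2 => smul_left_injective ℂ (hφ n) (A.mem_graph_snd_inj h2 h1 rfl), fun h2 => ?_⟩
  rwa [h2]

/-- `T` and its inverse are bounded, hence commute with derivatives and integrals in time; the
correspondence of solutions reduces to that of the graphs. -/
theorem mapsSystem_of_graph_iff {E : Type*} [NormedAddCommGroup E] [NormedSpace ℂ E]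
    {T : E ≃L[ℂ] E} {G₁ G₂ : E → E → Prop} (h : ∀ f g, G₁ f g ↔ G₂ (T f) (T g)) :
    MapsSystem T G₁ G₂ := by
  refine ⟨h, fun u => ⟨?_, ?_⟩, fun u => ?_⟩
  · rintro ⟨u', hu', hu⟩
    exact ⟨fun t => T (u' t), T.continuous.comp_continuousOn hu', fun t ht =>
      ⟨((T : E →L[ℂ] E).restrictScalars ℝ).hasFDerivAt.comp_hasDerivWithinAt t (hu t ht).1,
        (h _ _).1 (hu t ht).2⟩⟩
  · rintro ⟨v', hv', hv⟩
    refine ⟨fun t => T.symm (v' t), T.symm.continuous.comp_continuousOn hv', fun t ht =>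
      ⟨?_, (h _ _).2 (by rw [T.apply_symm_apply]; exact (hv t ht).2)⟩⟩
    have := ((T.symm : E →L[ℂ] E).restrictScalars ℝ).hasFDerivAt.comp_hasDerivWithinAt t
      (hv t ht).1
    refine this.congr_of_mem (fun s _ => ?_) ht
    exact (T.symm_apply_apply (u s)).symm
  · refine and_congr ⟨T.continuous.comp_continuousOn, fun hc => ?_⟩
      (forall₂_congr fun t _ => ?_)
    · refine (T.symm.continuous.comp_continuousOn hc).congr fun s _ => ?_
      exact (T.symm_apply_apply (u s)).symm
    · have e : ∫ s in (0 : ℝ)..t, T (u s) = T (∫ s in (0 : ℝ)..t, u s) := by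
        rw [intervalIntegral, intervalIntegral, map_sub, T.integral_comp_comm,
          T.integral_comp_comm]
      rw [e, ← map_sub]
      exact h _ _

end Systems

/-! ### The main theorem -/

theorem mainTheorem11
    {X : Type*} [NormedAddCommGroup X] [InnerProductSpace ℂ X] [CompleteSpace X]
    -- `A` generates a strongly continuous semigroup on `X`
    (A : X →ₗ.[ℂ] X) (S : ℝ → X →L[ℂ] X) (hS : IsC0Semigroup S) (hA : IsGeneratorOf A S)
    -- a Riesz basis of eigenvectors, split into `m` families with simple eigenvalues
    (m : ℕ) (φ : Fin m → ℕ+ → X) (μ : Fin m → ℕ+ → ℂ)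
    (hφ : IsRieszBasis (fun j : Fin m × ℕ+ => φ j.1 j.2))
    (heig : ∀ i n, (φ i n, μ i n • φ i n) ∈ A.graph)
    (hsimple : ∀ i, Function.Injective (μ i))
    -- growth and gap of the eigenvalues
    (α : Fin m → ℝ) (hα : ∀ i, 1 < α i)
    (hgrowth : ∃ c C : ℝ, 0 < c ∧ 0 < C ∧ ∀ (i : Fin m) (n : ℕ+),
      c * ((n : ℕ) : ℝ) ^ α i ≤ ‖μ i n‖ + 1 ∧ ‖μ i n‖ + 1 ≤ C * ((n : ℕ) : ℝ) ^ α i)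
    (hgap : ∃ C : ℝ, 0 < C ∧ ∀ (i : Fin m) (n p : ℕ+),
      C * ((n : ℕ) : ℝ) ^ (α i - 1) * |((n : ℕ) : ℝ) - ((p : ℕ) : ℝ)| ≤ ‖μ i n - μ i p‖)
    -- parameters and control operator
    (β γ : Fin m → ℝ) (hγ : ∀ i, 0 ≤ γ i ∧ γ i < (α i - 1) / 2)
    (i : Fin m) (B : SeriesSpace (φ i) (β i - α i / 2))
    (hB : ∃ c₁ c₂ : ℝ, 0 < c₁ ∧ 0 < c₂ ∧ ∀ n : ℕ+,
      c₁ * ((n : ℕ) : ℝ) ^ (-β i) ≤ ‖B.coeff n‖ ∧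
        ‖B.coeff n‖ ≤ c₂ * ((n : ℕ) : ℝ) ^ (-β i + γ i))
    (lam : ℝ) (hlam : 0 ≤ lam) (hres : ∀ (j : Fin m) (n p : ℕ+), (lam : ℂ) ≠ μ j n - μ j p) :
    ∃ (K : Feedback (φ i) (β i + 1 / 2))
      (T : ScaleIso (φ i) (β i + 1 / 2 - α i + γ i) (β i + α i - 1 / 2 - γ i)),
      ∀ (r : ℝ) (hr : r ∈ Set.Ioo (β i + 1 / 2 - α i + γ i) (β i + α i - 1 / 2 - γ i)),
        MapsSystem (T.toEquiv r hr) (ClosedLoop A B K r) (Target A (lam : ℂ) r) := by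

  obtain ⟨c, _, hc, -, hgrow⟩ := hgrowth
  obtain ⟨C, hC, hgap⟩ := hgap
  obtain ⟨c₁, c₂, hc₁, hc₂, hb⟩ := hB
  have hα := hα i
  obtain ⟨hγ, hγα'⟩ := hγ i
  have hγα : γ i < α i - 1 := by linarith
  have h : HasGap (α i) C (μ i) := hgap i
  have hres : ∀ n p, (lam : ℂ) ≠ μ i n - μ i p := hres i
  have hb : ControlBounds (β i) (γ i) c₁ c₂ B.coeff := hb
  have hne := hb.ne_zero hc₁
  have happly : ∀ f g : ℕ+ → ℂ, SeriesApply A (φ i) f g ↔ ∀ n, g n = μ i n * f n := fun f g =>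
    seriesApply_iff (heig i) fun n => hφ.ne_zero (i, n)
  choose T hT hS using fun (r : ℝ)
    (hr : r ∈ Ioo (β i + 1 / 2 - α i + γ i) (β i + α i - 1 / 2 - γ i)) =>
    exists_cauchyEquiv (φ i) hα hC h hres hc₁ hc₂ hb hγ hγα hr
  choose K hK using fun (s : ℝ) (hs : β i + 1 / 2 < s) =>
    exists_feedbackFunctional (φ i) hα hC h (lam : ℂ) hc₁ hb hs
  refine ⟨⟨K, fun s s' hs hs' f g hfg => ?_⟩, ⟨T, fun r r' hr hr' f g hfg => ?_⟩, fun r hr =>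
    mapsSystem_of_graph_iff fun f g => ⟨?_, ?_⟩⟩
  · have := hK s hs f
    rw [hfg] at this
    exact this.unique (hK s' hs' g)
  · funext p
    have := hT r hr f p
    rw [hfg] at this
    exact this.unique (hT r' hr' g p)
  · rintro ⟨s, hs, f', k, hf', hk, hg⟩
    rw [happly] at hk
    refine ⟨fun n => μ i n * (T r hr f).coeff n, (happly _ _).2 fun n => rfl, ?_⟩
    have hκ := hK s hs f'
    rw [hf'] at hκ
    exact coeff_transform_closedLoop hα hC h hres hne (hT r hr) hκ fun n => by rw [hg, hk]
  · rintro ⟨k, hk, hz⟩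
    rw [happly] at hk
    have hz' : ∀ p, (T r hr g).coeff p =
        μ i p * (T r hr f).coeff p - lam * (T r hr f).coeff p := fun p => by
      rw [← hk]; exact hz p
    -- Above β + 1/2 the feedback is defined, below β + α - 1/2 - γ the map T is invertible on 𝓗ˢ,
    -- and s ≤ r + α puts T f in 𝓗ˢ. There is room because γ < α - 1 and r > β + 1/2 - α + γ.
    obtain ⟨s, hs1, hs2⟩ : ∃ s, β i + 1 / 2 < s ∧
        s < min (β i + α i - 1 / 2 - γ i) (r + α i) :=
      exists_between (lt_min (by linarith) (by linarith [hr.1]))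
    have hs : s ∈ Ioo (β i + 1 / 2 - α i + γ i) (β i + α i - 1 / 2 - γ i) :=
      ⟨by linarith, hs2.trans_le (min_le_left _ _)⟩
    let w : SeriesSpace (φ i) s := ⟨(T r hr f).coeff,
      mem_weightedSeq_of_target hc (by linarith) (fun n => (hgrow i n).1) (T r hr g).2 hz'
        (hs2.trans_le (min_le_right _ _)).le⟩
    obtain ⟨L, hL⟩ := exists_feedbackFunctional (φ i) hα hC h.neg (lam : ℂ) hc₁ hb hs1
    -- The inverses on 𝓗ʳ and 𝓗ˢ are given by the same matrix, so `f` itself belongs to 𝓗ˢ.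
    have hf : ((T s hs).symm w).coeff = f.coeff := funext fun n => by
      have h1 := hS r hr (T r hr f) n
      rw [(T r hr).symm_apply_apply] at h1
      exact (hS s hs w n).unique h1
    refine ⟨s, hs1, (T s hs).symm w, fun n => μ i n * f.coeff n, hf,
      (happly _ _).2 fun n => rfl, fun n => ?_⟩
    have h1 := coeff_inverse_target hres (hS r hr) (w := T r hr f) (hL w) hz' n
    rw [(T r hr).symm_apply_apply, (T r hr).symm_apply_apply] at h1
    -- The scalar `L w` produced by the inverse conjugation is the feedback K f.
    have h2 := feedback_comp_eq hα hC h hres hne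
      (S := ((T s hs).symm : SeriesSpace (φ i) s →L[ℂ] SeriesSpace (φ i) s)) (hS s hs)
      (hK s hs1) hL w
    rw [h1, ← h2]
    rfl
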